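/- **Setting.** Let $p$ be a prime, $N\ge 1$ an integer prime to $p$, $\alpha\ge 1$ an integer, and $K$ a field that is complete for a non-archimedean absolute value $|\cdot|$ extending the $p$-adic absolute value of $\mathbb{Q}_p\subset K$ and that contains a primitive $N$-th root of unity $\xi$ (for instance $K=\mathrm{Frac}\,W(\mathbb{F}_q)$ with $\mathbb{F}_q$ of characteristic $p$ containing a primitive $N$-th root of unity). Let $v_p(x)=-\log|x|/\log p$, $v_p(0)=+\infty$, and $z_i=\xi^i$ for $1\le i\le N$. **Expansions.** Let $\mathcal{S}_\alpha$ be the space of sequences $(b_l)_{l\ge 0}$ in $K$ for which there are $\kappa,\kappa',\kappa''>0$ with $|b_l|\le p^{\kappa+\frac{\kappa'}{\log p}\log(l+\kappa'')+(\alpha-1)l}$ for all $l$. An expansion of a sequence $c:\mathbb{N}^*\to K$ at $n_0\in\mathbb{Z}_p$ is a family $(c^{(l,i)}(n_0))_{l\ge 0,\,1\le i\le N}$ with $(c^{(l,i)}(n_0))_l\in\mathcal{S}_\alpha$ for each $i$ and $c(n)=\sum_{l\ge 0}\sum_{i=1}^N c^{(l,i)}(n_0)\,\xi^{-in}(n-n_0)^l$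 for all $n\in\mathbb{N}^*$ with $|n-n_0|_p\le p^{-\alpha}$. Let $\mathrm{LAE}^{\mathrm{reg}}$ be the space of sequences having an expansion at every $n_0\in\mathbb{Z}_p$. Let $\mathrm{LAE}^{\mathrm{pol}}$ be the space of sequences having an expansion at every $n_0$ with $|n_0|_p>p^{-\alpha}$ and, for $|n|_p\le p^{-\alpha}$, an expansion at $0$ of the same kind but starting at $l=-1$. Put $\mathrm{reg}(c)(n)=c(n)-\sum_{i=1}^N c^{(-1,i)}(0)\,\mathbf{1}_{p^\alpha\mid n}\,\xi^{-in}/n$ for $c\in\mathrm{LAE}^{\mathrm{pol}}$. **Regularized iterated integrals.** Words are words over the alphabet $e_Z=\{e_0,e_{z_1},\dots,e_{z_N}\}$; the weight of a word is its number of letters, and its depth is its number of letters different from $e_0$. Let $e_0$ correspond to $p^\alpha\frac{dz}{z}$ and $e_{z_i}$ to $p^\alpha\frac{dz}{z-z_i}$. For a word $w$ whose rightmost letter is not $e_0$, define a power series $\int_{\mathrm{reg}}w\in K[[z]]$ by $\int_{\mathrm{reg}}\emptyset=1$ and by letting $\int_{\mathrm{reg}}e_x w'$ be the series with constant term $0$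 whose sequence of coefficients is the image under $\mathrm{reg}$ of the sequence of coefficients of $\int_0^z e_x\int_{\mathrm{reg}}w'$. Let $c_w:\mathbb{N}^*\to K$ be the sequence of coefficients of $\int_{\mathrm{reg}}w$. **Proposition.** Let $w$ be a word over $e_Z$ whose rightmost letter is not $e_0$, of depth $d+1$ with $d\ge 0$ and of weight $s$. Then $c_w\in\mathrm{LAE}^{\mathrm{reg}}$, and: i) for all $r\in\{0,\dots,p^\alpha-1\}$, $l\in\mathbb{N}$ and $i\in\{1,\dots,N\}$, the coefficients of the expansion of $c_w$ at $r$ satisfy $$v_p\big(c_w^{(l,i)}(r)\big)\ \ge\ s-2d-\frac{d}{\log p}\log\Big(\max\big(l+s+1-d,\tfrac{d}{\log p}\big)\Big)-(\alpha-1)l\,;$$ ii) $c_w$ extends to a continuous function on $\mathbb{Z}_p^{(N)}=\varprojlim_l\mathbb{Z}/Np^l\mathbb{Z}\simeq \mathbb{Z}/N\mathbb{Z}\times\mathbb{Z}_p$, and for all $n\in\mathbb{Z}_p^{(N)}$ $$v_p\big(c_w(n)\big)\ \ge\ s-2d-\frac{d}{\log p}\log(s+1+d).$$ -/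

import Mathlib

noncomputable section

namespace PAdicHyperlog

open PowerSeries

/-- The alphabet `e_0, e_{z_1}, …, e_{z_N}` with `z_i = ξ ^ i`. The index `i` runs through `Fin N`,
the value `0` standing for `i = N` (for both, `z_i = 1`). -/
inductive Letter (N : ℕ) : Type
  | e0 : Letter N
  | e (i : Fin N) : Letter N

/-- `true` exactly on the letters different from `e_0`. -/
def Letter.isSingular {N : ℕ} : Letter N → Bool
  | .e0 => false
  | .e _ => true

/-- Words `e_{i_v} … e_{i_1}` are lists read from left to right, so the head of the list is the
outermost differential form and the last entry is the innermost one. -/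
abbrev Word (N : ℕ) : Type := List (Letter N)

/-- The weight is the number of letters. -/
def Word.weight {N : ℕ} (w : Word N) : ℕ := w.length

/-- The depth is the number of letters different from `e_0`. -/
def Word.depth {N : ℕ} (w : Word N) : ℕ := w.countP Letter.isSingular

/-- Convergent words: those whose furthest to the right letter is not `e_0`. -/
def Word.IsConvergent {N : ℕ} (w : Word N) : Prop := w.getLast? ≠ some Letter.e0

/-- The normalized additive valuation `v_p(x) = - log ‖x‖ / log p`, with `v_p(0) = +∞`. -/
def vp (p : ℕ) {K : Type*} [NormedField K] (x : K) : EReal :=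
  open scoped Classical in if x = 0 then ⊤ else ((-(Real.log ‖x‖ / Real.log p) : ℝ) : EReal)

/-- The space `S_α` of sequences `b` with
`|b_l| ≤ p ^ (κ + (κ' / log p) log (l + κ'') + (α - 1) l)` for some `κ, κ', κ'' > 0`. -/
def IsInS (p α : ℕ) {K : Type*} [NormedField K] (b : ℕ → K) : Prop :=
  ∃ κ κ' κ'' : ℝ, 0 < κ ∧ 0 < κ' ∧ 0 < κ'' ∧ ∀ l : ℕ,
    ‖b l‖ ≤ (p : ℝ) ^ (κ + κ' / Real.log p * Real.log (l + κ'') + ((α : ℝ) - 1) * l)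

section

variable (p : ℕ) [Fact p.Prime] {K : Type*} [NormedField K] [NormedAlgebra ℚ_[p] K]
  (N α : ℕ) (ξ : K)

/-- `κ l i` (`l ∈ ℕ`, `i ∈ Fin N`) are coefficients of an analytic-exponential expansion of the
sequence `c` at `n₀`: they lie in `S_α`, and
`c(n) = ∑_l ∑_i κ l i * ξ ^ (-i n) * (n - n₀) ^ l` for all integers `n ≥ 1` with
`|n - n₀|_p ≤ p ^ (-α)`. (Membership in `S_α` makes the series converge absolutely.) -/
def IsExpansionAt (c : ℕ → K) (n₀ : ℤ_[p]) (κ : ℕ → Fin N → K) : Prop :=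
  (∀ i, IsInS p α (fun l => κ l i)) ∧
  ∀ n : ℕ, 1 ≤ n → ‖(n : ℤ_[p]) - n₀‖ ≤ (p : ℝ) ^ (-(α : ℤ)) →
    HasSum (fun l : ℕ => ∑ i : Fin N, κ l i * (ξ ^ ((i : ℕ) * n))⁻¹ *
      (algebraMap ℚ_[p] K (((n : ℤ_[p]) - n₀ : ℤ_[p]) : ℚ_[p])) ^ l) (c n)

/-- The space `LAE^reg`: sequences on `ℕ \ {0}` (the value at `0` is irrelevant) that have an
analytic-exponential expansion at every `n₀ ∈ ℤ_p`. -/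
def IsLAEReg (c : ℕ → K) : Prop :=
  ∀ n₀ : ℤ_[p], ∃ κ : ℕ → Fin N → K, IsExpansionAt p N α ξ c n₀ κ

/-- `c` belongs to the space `LAE^pol`, with polar coefficients `c^{(-1,i)}(0) = a i`: it has an
expansion at every `n₀` outside of the disk `|n₀|_p ≤ p ^ (-α)`, and on this disk it has an
expansion around `0` as above, but starting at `l = -1`, the term of index `l = -1` being
`∑_i a i * ξ ^ (-i n) * n ^ (-1)`. -/
def IsLAEPolWith (c : ℕ → K) (a : Fin N → K) : Prop :=
  (∃ κ : ℕ → Fin N → K,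
    IsExpansionAt p N α ξ
      (fun n => c n - ∑ i : Fin N, a i * (ξ ^ ((i : ℕ) * n))⁻¹ * (n : K)⁻¹) 0 κ) ∧
  ∀ n₀ : ℤ_[p], (p : ℝ) ^ (-(α : ℤ)) < ‖n₀‖ →
    ∃ κ : ℕ → Fin N → K, IsExpansionAt p N α ξ c n₀ κ

open scoped Classical in
/-- The polar coefficients `c^{(-1,i)}(0)` of an element of `LAE^pol` (they are unique), and `0`
for any other sequence. -/
def polarCoeff (c : ℕ → K) : Fin N → K :=
  if h : ∃ a, IsLAEPolWith p N α ξ c a then h.choose else 0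

/-- The sequence `f_i : n ↦ 1_{p^α ∣ n} ξ ^ (-i n) / n`. -/
def polarSeq (i : Fin N) (n : ℕ) : K :=
  if p ^ α ∣ n then (ξ ^ ((i : ℕ) * n))⁻¹ * (n : K)⁻¹ else 0

/-- The regularization `LAE^pol → LAE^reg`, `c ↦ c - ∑_i c^{(-1,i)}(0) f_i`. -/
def regLAE (c : ℕ → K) (n : ℕ) : K :=
  c n - ∑ i : Fin N, polarCoeff p N α ξ c i * polarSeq p N α ξ i n

variable {N}

/-- The power series `g` with `ω = g(z) dz/z`, where `ω = dz/z` for the letter `e_0` and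
`ω = dz/(z - z_i)` for the letter `e_{z_i}`, so that `g = 1` and `g = z/(z - z_i)`. -/
def formSeries : Letter N → K⟦X⟧
  | .e0 => 1
  | .e i => X * (X - C (ξ ^ (i : ℕ)))⁻¹

/-- Integration from `0` against the form attached to a letter, `f ↦ ∫_0^z f · p^α ω`, on power
series: since `∫_0^z z ^ n dz/z = z ^ n / n`, the coefficient of index `n ≥ 1` of `f g` is
multiplied by `p ^ α / n`; the constant term of the result is `0`. -/
def integrate (x : Letter N) (f : K⟦X⟧) : K⟦X⟧ :=
  PowerSeries.mk fun n => (p : K) ^ α * coeff n (f * formSeries ξ x) / (n : K)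

/-- The regularized iterated integral of a word, as a power series in `z`: the empty word gives `1`,
and `x w` gives the series with constant term `0` whose sequence of coefficients is the
regularization of the sequence of coefficients of `∫ (p^α ω_x) ∫_reg w`. -/
def regIntegral : Word N → K⟦X⟧
  | [] => 1
  | x :: w => PowerSeries.mk fun n =>
      if n = 0 then 0 else
        regLAE p N α ξ (fun m => coeff m (integrate p α ξ x (regIntegral w))) n

/-- The sequence of Taylor coefficients at `0` of the regularized iterated integral of `w`. -/
def regIntegralCoeff (w : Word N) (n : ℕ) : K := coeff n (regIntegral p α ξ w)

end

/-- The space `ℤ_p^{(N)} = lim ℤ/N p^l ℤ`, the disjoint union of `N` copies `m + N ℤ_p` of `ℤ_p`;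
for `p` prime to `N` it is the product below. -/
abbrev ZpN (p N : ℕ) [Fact p.Prime] : Type := ZMod N × ℤ_[p]

/-- The dense embedding of the natural numbers. -/
def ZpN.ofNat (p N : ℕ) [Fact p.Prime] (n : ℕ) : ZpN p N := ((n : ZMod N), (n : ℤ_[p]))

end PAdicHyperlog

end

/-!
On each class `n = p ^ α u + r` modulo `p ^ α` the sequence `c_w` is, as a function of `u`, a
combination `∑_i η ^ (i u) g_i(u)` of the characters of `ℤ/N`, `η = ξ ^ (-p ^ α)`, where the `g_i`
are sums of power series in `u` (`ExpAnalytic`, `ClassAnalytic`). In the variable `u`, the bound of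
the statement on the coefficient of index `l` becomes `depthBound p d (l + s)`: weight and index
enter only through their sum. This bound is nonincreasing in `l + s`, and decreases by at most a
factor `p` at each step.

The proof is an induction on the word (`exists_classAnalytic_regIntegralCoeff`). Adding a letter
has two effects on the sequence of coefficients.

* A letter `e_{z_i}` multiplies the power series by `z / (z - z_i)`, which replaces `c` by a twisted
  partial sum `-ξ ^ (-i n) ∑_{m < n} ξ ^ (i m) c(m)`. Expanding `c` on the classes reduces this to
  the sums `∑_{v < u} q ^ v v ^ l` with `q ^ N = 1`. If `q ≠ 1`, then `q - 1` is a `p`-adic unit and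
  the difference equation `q Q(u + 1) - Q(u) = u ^ l` has an integral polynomial solution. If
  `q = 1`, Faulhaber's formula applies, and the coefficient of `u ^ m` has norm at most `p m`, as
  the Bernoulli numbers have at most one `p` in the denominator. Hence bounds `B` become
  `sumBound p B` (`ClassAnalytic.twistedPartialSum`), and the loss is accounted for by the change of
  depth (`mul_depthBound_le`).
* Any letter multiplies by `p ^ α / n`. On the classes `r ≠ 0` this is a geometric series in `u`
  with ratio divisible by `p`, so it gains one unit of weight. On the class `r = 0` it is division
  by `u`, which shifts the index `l` by one and leaves a polar part; that shift again amounts to one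
  unit of weight (`ClassAnalytic.exists_regularization`).

To identify the polar part with the one removed by `regLAE`, and to pass from one expansion to
all expansions, one needs uniqueness (`eq_zero_of_hasSum_characters`). Expansions at arbitrary
points of `ℤ_p` arise from those at `0 ≤ r < p ^ α` by translation, and the continuous extension is
given by the sums of the expansions.
-/

noncomputable section

namespace PAdicHyperlog

open Filter Topology

/-! ### Series in complete ultrametric fields -/

section Ultrametric

variable {K : Type*} [NormedField K] [IsUltrametricDist K]

theorem norm_le_of_hasSum {ι : Type*} {f : ι → K} {a : K} {C : ℝ} (h : HasSum f a) (hC : 0 ≤ C)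
    (hf : ∀ i, ‖f i‖ ≤ C) : ‖a‖ ≤ C :=
  le_of_tendsto h.norm (Eventually.of_forall fun _ =>
    IsUltrametricDist.norm_sum_le_of_forall_le_of_nonneg hC fun i _ => hf i)

theorem norm_sub_le_max (x y : K) : ‖x - y‖ ≤ max ‖x‖ ‖y‖ := by
  simpa [sub_eq_add_neg] using IsUltrametricDist.norm_add_le_max x (-y)

variable [CompleteSpace K]

theorem summable_of_norm_le_of_tendsto {f : ℕ → K} {D : ℕ → ℝ} (hD : Tendsto D atTop (𝓝 0))
    (hf : ∀ l, ‖f l‖ ≤ D l) : Summable f := by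
  refine NonarchimedeanAddGroup.summable_of_tendsto_cofinite_zero ?_
  rw [Nat.cofinite_eq_atTop]
  exact squeeze_zero_norm hf hD

/-- A double series whose `l`-th row is supported on `m ≤ l + 1` and bounded by `D l → 0` is
summable: in a complete ultrametric group it suffices that the terms tend to `0`. -/
theorem summable_prod_of_norm_le {F : ℕ → ℕ → K} {D : ℕ → ℝ} (hD : Tendsto D atTop (𝓝 0))
    (hF : ∀ l m, ‖F l m‖ ≤ D l) (h0 : ∀ l m, l + 1 < m → F l m = 0) :
    Summable fun x : ℕ × ℕ => F x.1 x.2 := by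
  refine NonarchimedeanAddGroup.summable_of_tendsto_cofinite_zero ?_
  rw [Metric.tendsto_nhds]
  intro ε hε
  obtain ⟨L, hL⟩ := eventually_atTop.1 (hD.eventually (gt_mem_nhds hε))
  have hfin : Set.Finite ((Finset.range L ×ˢ Finset.range (L + 2) : Finset (ℕ × ℕ)) :
      Set (ℕ × ℕ)) := Finset.finite_toSet _
  refine hfin.subset ?_
  rintro ⟨l, m⟩ hx
  simp only [Set.mem_compl_iff, Set.mem_ofPred_eq, dist_zero_right, not_lt] at hx
  simp only [Finset.coe_product, Finset.coe_range, Set.mem_prod, Set.mem_Iio]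
  have hl : l < L := by
    by_contra hl
    exact absurd (hL l (not_lt.1 hl)) (not_lt.2 (hx.trans (hF l m)))
  refine ⟨hl, ?_⟩
  by_contra hm
  rw [h0 l m (by omega), norm_zero] at hx
  exact absurd hε (not_lt.2 hx)

/-- Rearrangement of `∑_l β_l P_l(x)` into a power series in `x`, where `P_l` is a polynomial of
degree at most `l + 1` with coefficients `P l m`. -/
theorem hasSum_rearrange {β : ℕ → K} {P : ℕ → ℕ → K} {D : ℕ → ℝ} (hD : Tendsto D atTop (𝓝 0))
    (hP : ∀ l m, ‖β l * P l m‖ ≤ D l) (h0 : ∀ l m, l + 1 < m → P l m = 0) {x S : K}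
    (hx : ‖x‖ ≤ 1)
    (hS : HasSum (fun l => β l * ∑ m ∈ Finset.range (l + 2), P l m * x ^ m) S) :
    HasSum (fun m => (∑' l, β l * P l m) * x ^ m) S := by
  have hxm : ∀ m, ‖x ^ m‖ ≤ 1 := fun m => by
    rw [norm_pow]; exact pow_le_one₀ (norm_nonneg _) hx
  have hsum : Summable fun y : ℕ × ℕ => β y.1 * P y.1 y.2 * x ^ y.2 := by
    refine summable_prod_of_norm_le (F := fun l m => β l * P l m * x ^ m) hD (fun l m => ?_)
      (fun l m h => by simp [h0 l m h])
    rw [norm_mul]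
    exact (mul_le_of_le_one_right (norm_nonneg _) (hxm m)).trans (hP l m)
  obtain ⟨T, hT⟩ := hsum
  have hrow := hT.prod_fiberwise (g := fun l => β l * ∑ m ∈ Finset.range (l + 2), P l m * x ^ m)
    (fun l => by
      rw [Finset.mul_sum]
      have := hasSum_sum_of_ne_finset_zero (L := .unconditional ℕ)
        (f := fun m => β l * P l m * x ^ m) (s := Finset.range (l + 2)) (fun m hm => by
          rw [h0 l m (by have := Finset.mem_range.not.1 hm; omega)]; simp)
      simpa only [mul_assoc] using this)
  obtain rfl := hrow.unique hS
  have hT' := (Equiv.prodComm ℕ ℕ).hasSum_iff.2 hT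
  refine hT'.prod_fiberwise fun m => ?_
  have hs : Summable fun l => β l * P l m :=
    summable_of_norm_le_of_tendsto hD fun l => hP l m
  exact hs.hasSum.mul_right (x ^ m)

end Ultrametric

/-! ### Norms of integers and of roots of unity -/

section Norms

variable (p : ℕ) [Fact p.Prime] {K : Type*} [NormedField K] [NormedAlgebra ℚ_[p] K]

theorem norm_natCast_eq (n : ℕ) : ‖(n : K)‖ = ‖(n : ℚ_[p])‖ := by
  rw [← map_natCast (algebraMap ℚ_[p] K) n, norm_algebraMap']

theorem norm_natCast_le (p : ℕ) [Fact p.Prime] {K : Type*} [NormedField K] [NormedAlgebra ℚ_[p] K]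
    (n : ℕ) : ‖(n : K)‖ ≤ 1 := by
  rw [norm_natCast_eq p]
  exact_mod_cast Padic.norm_int_le_one (p := p) n

theorem norm_prime : ‖(p : K)‖ = (p : ℝ)⁻¹ := by
  rw [norm_natCast_eq p, Padic.norm_p]

theorem charZero_of_algebra (p : ℕ) [Fact p.Prime] (K : Type*) [NormedField K]
    [NormedAlgebra ℚ_[p] K] : CharZero K :=
  charZero_of_injective_algebraMap (algebraMap ℚ_[p] K).injective

theorem one_le_mul_norm_natCast (p : ℕ) [Fact p.Prime]
    {K : Type*} [NormedField K] [NormedAlgebra ℚ_[p] K]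
    {n : ℕ} (hn : n ≠ 0) : 1 ≤ n * ‖(n : K)‖ := by
  rw [norm_natCast_eq p, Padic.norm_eq_zpow_neg_valuation (by exact_mod_cast hn),
    Padic.valuation_natCast, zpow_neg, zpow_natCast]
  have hp : (0 : ℝ) < p := by exact_mod_cast (Fact.out : p.Prime).pos
  rw [← div_eq_mul_inv, one_le_div (by positivity)]
  exact_mod_cast Nat.le_of_dvd (Nat.pos_of_ne_zero hn) pow_padicValNat_dvd

theorem ne_zero_of_coprime {N : ℕ} (hN : p.Coprime N) : N ≠ 0 := by
  rintro rfl
  exact (Fact.out : p.Prime).one_lt.ne' (by simpa using hN)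

theorem norm_natCast_of_coprime {N : ℕ} (hN : p.Coprime N) : ‖(N : K)‖ = 1 := by
  rw [norm_natCast_eq p, Padic.norm_natCast_eq_one_iff]
  exact hN

/-- If `p ^ α` does not divide `r`, then `p` divides `p ^ α / r`. -/
theorem norm_pow_div_natCast_le {α r : ℕ} (hr : ¬ p ^ α ∣ r) :
    ‖(p : K) ^ α / (r : K)‖ ≤ (p : ℝ)⁻¹ := by
  have hp : (0 : ℝ) < p := by exact_mod_cast (Fact.out : p.Prime).pos
  have hr0 : r ≠ 0 := by rintro rfl; simp at hr
  have hα : padicValNat p r + 1 ≤ α := by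
    by_contra h
    exact hr ((pow_dvd_pow p (by omega)).trans (pow_padicValNat_dvd (p := p) (n := r)))
  rw [norm_div, norm_pow, norm_prime, norm_natCast_eq p,
    Padic.norm_eq_zpow_neg_valuation (by exact_mod_cast hr0), Padic.valuation_natCast, zpow_neg,
    zpow_natCast, div_inv_eq_mul, inv_pow, inv_mul_le_iff₀ (by positivity),
    ← div_eq_mul_inv, le_div_iff₀ hp, ← pow_succ]
  exact pow_le_pow_right₀ (by exact_mod_cast (Fact.out : p.Prime).one_le) hα

theorem norm_of_pow_eq_one {N : ℕ} (hN : N ≠ 0) {q : K} (hq : q ^ N = 1) : ‖q‖ = 1 :=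
  (isOfFinOrder_iff_pow_eq_one.2 ⟨N, Nat.pos_of_ne_zero hN, hq⟩).norm_eq_one

/-- Since `∑_{k < N} (1 - q ^ k) = N` is a `p`-adic unit, so is its divisor `1 - q`. -/
theorem norm_sub_one_of_pow_eq_one [IsUltrametricDist K] {N : ℕ} (hN : p.Coprime N) {q : K}
    (hq : q ^ N = 1) (hq1 : q ≠ 1) : ‖q - 1‖ = 1 := by
  have hN0 := ne_zero_of_coprime p hN
  have hqn := norm_of_pow_eq_one hN0 hq
  refine le_antisymm ?_ ?_
  · exact (norm_sub_le_max q 1).trans (by simp [hqn])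
  · have h0 : ∑ k ∈ Finset.range N, q ^ k = 0 := by
      rw [geom_sum_eq hq1, hq, sub_self, zero_div]
    have hsum : ∑ k ∈ Finset.range N, (q ^ k - 1) = -(N : K) := by
      rw [Finset.sum_sub_distrib, h0]; simp
    rw [← norm_natCast_of_coprime p (K := K) hN, ← norm_neg (N : K), ← hsum]
    refine IsUltrametricDist.norm_sum_le_of_forall_le_of_nonneg (norm_nonneg _) fun k _ => ?_
    rw [← geom_sum_mul q k, norm_mul]
    refine mul_le_of_le_one_left (norm_nonneg _) ?_
    refine IsUltrametricDist.norm_sum_le_of_forall_le_of_nonneg zero_le_one fun j _ => ?_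
    rw [norm_pow, hqn, one_pow]

end Norms

/-! ### Integrality of Bernoulli numbers -/

section PowerSums

variable (p : ℕ) [Fact p.Prime]

theorem norm_pow_div_succ_le (j : ℕ) : ‖(p : ℚ_[p]) ^ j / ((j + 1 : ℕ) : ℚ_[p])‖ ≤ 1 := by
  by_cases h : p ^ j ∣ j + 1
  -- `p ^ j ≥ j + 1`, so this divisibility forces `p ^ j = j + 1`, as happens for `p = 2`, `j = 1`.
  · have h1 := Nat.le_of_dvd (Nat.succ_pos j) h
    have h2 : 2 ^ j ≤ p ^ j := Nat.pow_le_pow_left (Fact.out : p.Prime).two_le j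
    have h3 := Nat.lt_two_pow_self (n := j)
    rw [show j + 1 = p ^ j by omega, Nat.cast_pow]
    rw [div_self (pow_ne_zero _ (by exact_mod_cast (Fact.out : p.Prime).ne_zero)), norm_one]
  · exact (norm_pow_div_natCast_le p h).trans
      (inv_le_one_of_one_le₀ (by exact_mod_cast (Fact.out : p.Prime).one_le))

/-- The denominators of the Bernoulli numbers are divisible by `p` at most once. -/
theorem norm_bernoulli_le (k : ℕ) : ‖((bernoulli k : ℚ) : ℚ_[p])‖ ≤ p := by
  induction k using Nat.strong_induction_on with
  | _ k ih =>
    have hp : (0 : ℝ) < p := by exact_mod_cast (Fact.out : p.Prime).pos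
    have hpne : (p : ℚ_[p]) ≠ 0 := by exact_mod_cast (Fact.out : p.Prime).ne_zero
    have h := congrArg (Rat.cast : ℚ → ℚ_[p]) (sum_range_pow p k)
    rw [Finset.sum_range_succ] at h
    push_cast at h
    have hk : ((k : ℚ_[p]) + 1) ≠ 0 := by exact_mod_cast Nat.succ_ne_zero k
    have hterm : ∀ i ∈ Finset.range k,
        ‖((bernoulli i : ℚ) : ℚ_[p]) * ((k + 1).choose i : ℚ_[p]) * (p : ℚ_[p]) ^ (k + 1 - i)
          / ((k : ℚ_[p]) + 1)‖ ≤ 1 := by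
      intro i hi
      have hi := Finset.mem_range.1 hi
      have hch : ((k + 1).choose i : ℚ_[p]) * ((k - i + 1 : ℕ) : ℚ_[p]) =
          (k.choose i : ℚ_[p]) * ((k : ℚ_[p]) + 1) := by
        have := Nat.choose_mul_succ_eq k i
        rw [show k + 1 - i = k - i + 1 by omega] at this
        exact_mod_cast this.symm
      have hki : ((k - i + 1 : ℕ) : ℚ_[p]) ≠ 0 := by exact_mod_cast Nat.succ_ne_zero (k - i)
      -- `C(k + 1, i) / (k + 1) = C(k, i) / (k - i + 1)`
      have heq : ((bernoulli i : ℚ) : ℚ_[p]) * ((k + 1).choose i : ℚ_[p]) *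
          (p : ℚ_[p]) ^ (k + 1 - i) / ((k : ℚ_[p]) + 1) =
          (((bernoulli i : ℚ) : ℚ_[p]) * p) * (k.choose i : ℚ_[p]) *
            ((p : ℚ_[p]) ^ (k - i) / ((k - i + 1 : ℕ) : ℚ_[p])) := by
        rw [show k + 1 - i = k - i + 1 by omega, pow_succ]
        generalize ((k - i + 1 : ℕ) : ℚ_[p]) = D at hch hki
        field_simp
        linear_combination (((bernoulli i : ℚ) : ℚ_[p])) * hch
      rw [heq, norm_mul, norm_mul, norm_mul, Padic.norm_p]
      refine mul_le_one₀ (mul_le_one₀ ?_ (norm_nonneg _) (norm_natCast_le p _)) (norm_nonneg _)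
        (norm_pow_div_succ_le p _)
      rw [← div_eq_mul_inv, div_le_one hp]
      exact ih i hi
    -- Faulhaber's formula for `∑_{x < p} x ^ k`, solved for its last term `p B_k`.
    have hlast : ((bernoulli k : ℚ) : ℚ_[p]) * p =
        ∑ x ∈ Finset.range p, (x : ℚ_[p]) ^ k - ∑ i ∈ Finset.range k,
          ((bernoulli i : ℚ) : ℚ_[p]) * ((k + 1).choose i : ℚ_[p]) * (p : ℚ_[p]) ^ (k + 1 - i)
          / ((k : ℚ_[p]) + 1) := by
      rw [h]
      simp
      field_simp
    have hn : ‖((bernoulli k : ℚ) : ℚ_[p]) * p‖ ≤ 1 := by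
      rw [hlast]
      refine (norm_sub_le_max _ _).trans (max_le ?_ ?_)
      · refine IsUltrametricDist.norm_sum_le_of_forall_le_of_nonneg zero_le_one fun x _ => ?_
        rw [norm_pow]
        exact pow_le_one₀ (norm_nonneg _) (norm_natCast_le p x)
      · exact IsUltrametricDist.norm_sum_le_of_forall_le_of_nonneg zero_le_one hterm
    rwa [norm_mul, Padic.norm_p, ← div_eq_mul_inv, div_le_one hp] at hn

end PowerSums

/-! ### Twisted sums of powers -/

section TwistedPowerSums

variable (p : ℕ) [Fact p.Prime] {K : Type*} [NormedField K] [NormedAlgebra ℚ_[p] K]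

theorem norm_inv_natCast_le (p : ℕ) [Fact p.Prime]
    {K : Type*} [NormedField K] [NormedAlgebra ℚ_[p] K]
    {m : ℕ} (hm : m ≠ 0) : ‖(m : K)‖⁻¹ ≤ m := by
  have h := one_le_mul_norm_natCast p (K := K) hm
  have hpos : 0 < ‖(m : K)‖ := by
    by_contra h0
    have : ‖(m : K)‖ = 0 := le_antisymm (not_lt.1 h0) (norm_nonneg _)
    rw [this] at h; norm_num at h
  rw [inv_le_iff_one_le_mul₀ hpos]
  exact h

/-- Faulhaber's formula: `∑_{v < u} v ^ l` is a polynomial in `u` without constant term. -/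
theorem exists_powerSum_coeff (K : Type*) [NormedField K] [NormedAlgebra ℚ_[p] K] (l : ℕ) :
    ∃ P : ℕ → K, P 0 = 0 ∧ (∀ m, m ≠ 0 → ‖P m‖ ≤ p * m) ∧ (∀ m, l + 1 < m → P m = 0) ∧
      ∀ u : ℕ, ∑ v ∈ Finset.range u, (v : K) ^ l =
        ∑ m ∈ Finset.range (l + 2), P m * (u : K) ^ m := by
  have := charZero_of_algebra p K
  refine ⟨fun m => if m = 0 ∨ l + 1 < m then 0 else
    ((bernoulli (l + 1 - m) * ((l + 1).choose m) / (l + 1) : ℚ) : K), by simp, ?_, ?_, ?_⟩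
  · intro m hm
    by_cases hlm : l + 1 < m
    · simp only [hlm, or_true, if_true, norm_zero]; positivity
    · obtain ⟨k, rfl⟩ := Nat.exists_eq_succ_of_ne_zero hm
      simp only [hm, hlm, or_false, if_false]
      have hl : ((l : K) + 1) ≠ 0 := by exact_mod_cast Nat.succ_ne_zero l
      have hk : ((k + 1 : ℕ) : K) ≠ 0 := by exact_mod_cast Nat.succ_ne_zero k
      have hch : ((l : K) + 1) * (l.choose k : K) =
          ((l + 1).choose (k + 1) : K) * ((k + 1 : ℕ) : K) := by
        exact_mod_cast Nat.add_one_mul_choose_eq l k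
      -- `C(l + 1, k + 1) / (l + 1) = C(l, k) / (k + 1)`
      have heq : ((bernoulli (l + 1 - (k + 1)) * ((l + 1).choose (k + 1)) / (l + 1) : ℚ) : K) =
          algebraMap ℚ_[p] K ((bernoulli (l + 1 - (k + 1)) : ℚ) : ℚ_[p]) * (l.choose k : K) *
            ((k + 1 : ℕ) : K)⁻¹ := by
        rw [map_ratCast]
        generalize bernoulli (l + 1 - (k + 1)) = b
        push_cast at hk hch ⊢
        field_simp
        linear_combination (-(b : K)) * hch
      rw [Nat.succ_eq_add_one, heq, norm_mul, norm_mul, norm_algebraMap', norm_inv]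
      refine mul_le_mul ?_ (norm_inv_natCast_le p hm) (by positivity) (by positivity)
      exact (mul_le_of_le_one_right (norm_nonneg _) (norm_natCast_le p _)).trans
        (norm_bernoulli_le p _)
  · intro m hm
    simp [hm]
  · intro u
    have h := congrArg (Rat.cast : ℚ → K) (sum_range_pow u l)
    push_cast at h
    rw [Finset.sum_range_succ', h, ← Finset.sum_range_reflect]
    simp only [true_or, if_true, zero_mul, add_zero]
    refine Finset.sum_congr rfl fun i hi => ?_
    have hi := Finset.mem_range.1 hi
    rw [if_neg (by omega), show l + 1 - (l + 1 - 1 - i) = i + 1 by omega,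
      show l + 1 - 1 - i = l + 1 - (i + 1) by omega,
      Nat.choose_symm (by omega : i + 1 ≤ l + 1)]
    push_cast
    ring

open Polynomial in
/-- For `q ≠ 1` with `q - 1` a `p`-adic unit, the difference equation
`q Q(u + 1) - Q(u) = u ^ l` has an integral polynomial solution. -/
theorem exists_twistedDifference (p : ℕ) [Fact p.Prime]
    {K : Type*} [NormedField K] [NormedAlgebra ℚ_[p] K]
    [IsUltrametricDist K] {q : K} (hq : ‖q‖ = 1)
    (hq1 : ‖q - 1‖ = 1) (l : ℕ) :
    ∃ Q : K[X], Q.natDegree ≤ l ∧ (∀ m, ‖Q.coeff m‖ ≤ 1) ∧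
      ∀ x : K, q * Q.eval (x + 1) - Q.eval x = x ^ l := by
  induction l using Nat.strong_induction_on with
  | _ l ih =>
    choose! Q hdeg hcoeff heval using ih
    have hne : q - 1 ≠ 0 := by
      intro h; rw [h, norm_zero] at hq1; exact zero_ne_one hq1
    refine ⟨C (q - 1)⁻¹ * (X ^ l - C q * ∑ k ∈ Finset.range l, C (l.choose k : K) * Q k),
      ?_, ?_, ?_⟩
    · refine (natDegree_C_mul_le _ _).trans ((natDegree_sub_le _ _).trans (max_le ?_ ?_))
      · simp
      · refine (natDegree_C_mul_le _ _).trans (natDegree_sum_le_of_forall_le _ _ fun k hk => ?_)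
        have hk := Finset.mem_range.1 hk
        exact (natDegree_C_mul_le _ _).trans ((hdeg k hk).trans hk.le)
    · intro m
      rw [coeff_C_mul, norm_mul, norm_inv, hq1, inv_one, one_mul, coeff_sub]
      refine (norm_sub_le_max _ _).trans (max_le ?_ ?_)
      · rw [coeff_X_pow]; split_ifs <;> simp
      · rw [coeff_C_mul, norm_mul, hq, one_mul, finsetSum_coeff]
        refine IsUltrametricDist.norm_sum_le_of_forall_le_of_nonneg zero_le_one fun k hk => ?_
        rw [coeff_C_mul, norm_mul]
        exact mul_le_one₀ (norm_natCast_le p _) (norm_nonneg _)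
          (hcoeff k (Finset.mem_range.1 hk) m)
    · intro x
      have hbin : (x + 1) ^ l = ∑ k ∈ Finset.range l, (l.choose k : K) * x ^ k + x ^ l := by
        rw [add_pow, Finset.sum_range_succ]
        simp [mul_comm]
      have hsum : q * ∑ k ∈ Finset.range l, (l.choose k : K) * (Q k).eval (x + 1) -
          ∑ k ∈ Finset.range l, (l.choose k : K) * (Q k).eval x =
          ∑ k ∈ Finset.range l, (l.choose k : K) * x ^ k := by
        rw [Finset.mul_sum, ← Finset.sum_sub_distrib]
        refine Finset.sum_congr rfl fun k hk => ?_
        rw [← heval k (Finset.mem_range.1 hk) x]; ring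
      simp only [eval_mul, eval_C, eval_sub, eval_pow, eval_X, eval_finsetSum]
      rw [hbin]
      field_simp
      linear_combination (-q) * hsum

/-- Sums `∑_{v < u} q ^ v v ^ l` with `q` a root of unity of order prime to `p`: up to a constant
they are `q ^ u` times a polynomial in `u` of degree at most `l + 1` with almost integral
coefficients. -/
theorem exists_twistedSum_coeff [IsUltrametricDist K] {N : ℕ} (hN : p.Coprime N) {q : K}
    (hq : q ^ N = 1) (l : ℕ) :
    ∃ P : ℕ → K, ‖P 0‖ ≤ 1 ∧ (∀ m, m ≠ 0 → ‖P m‖ ≤ p * m) ∧ (∀ m, l + 1 < m → P m = 0) ∧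
      ∀ u : ℕ, ∑ v ∈ Finset.range u, q ^ v * (v : K) ^ l =
        q ^ u * ∑ m ∈ Finset.range (l + 2), P m * (u : K) ^ m - P 0 := by
  have hN0 := ne_zero_of_coprime p hN
  by_cases hq1 : q = 1
  · obtain ⟨P, h0, h1, h2, h3⟩ := exists_powerSum_coeff p K l
    exact ⟨P, by simp [h0], h1, h2, fun u => by simp [hq1, h0, h3]⟩
  · obtain ⟨Q, hdeg, hcoeff, heval⟩ := exists_twistedDifference p
      (norm_of_pow_eq_one hN0 hq) (norm_sub_one_of_pow_eq_one p hN hq hq1) l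
    refine ⟨Q.coeff, hcoeff 0, fun m hm => (hcoeff m).trans ?_, fun m hm =>
      Polynomial.coeff_eq_zero_of_natDegree_lt (by omega), fun u => ?_⟩
    · have h1 : (1 : ℝ) ≤ p := by exact_mod_cast (Fact.out : p.Prime).one_le
      have h2 : (1 : ℝ) ≤ m := by exact_mod_cast Nat.one_le_iff_ne_zero.2 hm
      nlinarith
    · have hev : ∀ x : K, ∑ m ∈ Finset.range (l + 2), Q.coeff m * x ^ m = Q.eval x := fun x =>
        (Polynomial.eval_eq_sum_range' (by omega) x).symm
      rw [hev, Polynomial.coeff_zero_eq_eval_zero]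
      have := Finset.sum_range_sub (fun v : ℕ => q ^ v * Q.eval (v : K)) u
      simp only [Nat.cast_zero, pow_zero, one_mul] at this
      rw [← this]
      refine Finset.sum_congr rfl fun v _ => ?_
      rw [← heval (v : K)]
      push_cast
      ring

end TwistedPowerSums

/-! ### Sums of power series with bounded coefficients -/

section AnalyticWith

variable {K : Type*} [NormedField K]

/-- The function `g` on `ℕ` is the sum of a power series whose coefficient of index `l` has norm
at most `B l`. -/
def AnalyticWith (B : ℕ → ℝ) (g : ℕ → K) : Prop :=
  ∃ β : ℕ → K, (∀ l, ‖β l‖ ≤ B l) ∧ ∀ u : ℕ, HasSum (fun l => β l * (u : K) ^ l) (g u)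

/-- Bounds for the coefficients of the partial sums of a power series with bounds `B`. -/
def sumBound (p : ℕ) (B : ℕ → ℝ) : ℕ → ℝ
  | 0 => B 0
  | m + 1 => p * (m + 1) * B m

namespace AnalyticWith

variable {B C : ℕ → ℝ} {g : ℕ → K}

theorem mono (hBC : ∀ l, B l ≤ C l) (hg : AnalyticWith B g) : AnalyticWith C g := by
  obtain ⟨β, hβ, hs⟩ := hg
  exact ⟨β, fun l => (hβ l).trans (hBC l), hs⟩

theorem const (hB : ∀ l, 0 ≤ B l) {a : K} (ha : ‖a‖ ≤ B 0) :
    AnalyticWith B fun _ => a := by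
  refine ⟨fun l => if l = 0 then a else 0, fun l => ?_, fun u => ?_⟩
  · by_cases h : l = 0
    · subst h; simpa using ha
    · simpa [h] using hB l
  · convert hasSum_ite_eq (0 : ℕ) a using 2 with l
    split_ifs with h <;> simp [h]

theorem zero (hB : ∀ l, 0 ≤ B l) : AnalyticWith B fun _ => (0 : K) :=
  const hB (by simpa using hB 0)

theorem const_mul (hg : AnalyticWith B g) (a : K) :
    AnalyticWith (fun l => ‖a‖ * B l) fun u => a * g u := by
  obtain ⟨β, hβ, hs⟩ := hg
  refine ⟨fun l => a * β l, fun l => ?_, fun u => ?_⟩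
  · rw [norm_mul]; exact mul_le_mul_of_nonneg_left (hβ l) (norm_nonneg _)
  · simpa [mul_assoc] using (hs u).mul_left a

theorem add [IsUltrametricDist K] {h : ℕ → K} (hg : AnalyticWith B g) (hh : AnalyticWith B h) :
    AnalyticWith B fun u => g u + h u := by
  obtain ⟨β, hβ, hs⟩ := hg
  obtain ⟨γ, hγ, ht⟩ := hh
  refine ⟨fun l => β l + γ l, fun l => ?_, fun u => ?_⟩
  · exact (IsUltrametricDist.norm_add_le_max _ _).trans (max_le (hβ l) (hγ l))
  · simpa [add_mul] using (hs u).add (ht u)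

/-- Splitting off the constant term. -/
theorem exists_eq_add_mul [IsUltrametricDist K] [CompleteSpace K] (hg : AnalyticWith B g)
    (p : ℕ) [Fact p.Prime] [NormedAlgebra ℚ_[p] K]
    (hBC : ∀ l, B (l + 1) ≤ C l) (hC : Tendsto C atTop (𝓝 0)) :
    ∃ (a : K) (h : ℕ → K), AnalyticWith C h ∧ ∀ u : ℕ, g u = a + u * h u := by
  obtain ⟨β, hβ, hs⟩ := hg
  have hsum : ∀ u : ℕ, Summable fun l => β (l + 1) * (u : K) ^ l := fun u =>
    summable_of_norm_le_of_tendsto hC fun l => by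
      rw [norm_mul, norm_pow]
      exact (mul_le_of_le_one_right (norm_nonneg _)
        (pow_le_one₀ (norm_nonneg _) (norm_natCast_le p u))).trans ((hβ _).trans (hBC l))
  refine ⟨β 0, fun u => ∑' l, β (l + 1) * (u : K) ^ l,
    ⟨fun l => β (l + 1), fun l => (hβ _).trans (hBC l), fun u => (hsum u).hasSum⟩, fun u => ?_⟩
  rw [← (hs u).tsum_eq, (hs u).summable.tsum_eq_zero_add, ← (hsum u).tsum_mul_left]
  simp only [pow_zero, mul_one]
  congr 2
  ext l
  ring

/-- Division by a linear polynomial `1 - t u` with `|t| ≤ 1 / p`: the coefficients of the quotient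
satisfy `γ_{l+1} = t γ_l + β_{l+1}`. -/
theorem exists_mul_eq [IsUltrametricDist K] [CompleteSpace K] (hg : AnalyticWith B g)
    (p : ℕ) [Fact p.Prime] [NormedAlgebra ℚ_[p] K]
    (hBC : ∀ l, B l ≤ C l) (hCC : ∀ l, (p : ℝ)⁻¹ * C l ≤ C (l + 1))
    (hC : Tendsto C atTop (𝓝 0)) {t : K} (ht : ‖t‖ ≤ (p : ℝ)⁻¹) :
    ∃ h : ℕ → K, AnalyticWith C h ∧ ∀ u : ℕ, (1 - t * u) * h u = g u := by
  obtain ⟨β, hβ, hs⟩ := hg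
  let γ : ℕ → K := fun l => Nat.rec (β 0) (fun l y => t * y + β (l + 1)) l
  have hγ0 : γ 0 = β 0 := rfl
  have hγ : ∀ l, γ (l + 1) = t * γ l + β (l + 1) := fun _ => rfl
  have hγC : ∀ l, ‖γ l‖ ≤ C l := by
    intro l
    induction l with
    | zero => exact (hβ 0).trans (hBC 0)
    | succ l ih =>
      rw [hγ]
      refine (IsUltrametricDist.norm_add_le_max _ _).trans (max_le ?_ ((hβ _).trans (hBC _)))
      rw [norm_mul]
      exact (mul_le_mul ht ih (norm_nonneg _) (by positivity)).trans (hCC l)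
  have hsum : ∀ u : ℕ, Summable fun l => γ l * (u : K) ^ l := fun u =>
    summable_of_norm_le_of_tendsto hC fun l => by
      rw [norm_mul, norm_pow]
      exact (mul_le_of_le_one_right (norm_nonneg _)
        (pow_le_one₀ (norm_nonneg _) (norm_natCast_le p u))).trans (hγC l)
  refine ⟨fun u => ∑' l, γ l * (u : K) ^ l, ⟨γ, hγC, fun u => (hsum u).hasSum⟩, fun u => ?_⟩
  have h1 := (hsum u).hasSum
  have h2 := (hasSum_nat_add_iff' 1).2 h1
  have h3 := (hasSum_nat_add_iff' 1).2 (hs u)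
  have h4 := (h1.mul_left (t * u)).add h3
  simp only [Finset.range_one, Finset.sum_singleton, pow_zero, mul_one] at h2 h4
  have h5 := h2.unique (h4.congr_fun fun l => by rw [hγ]; ring)
  rw [hγ0] at h5
  linear_combination h5

/-- Twisted partial sums of a power series. The constant that is subtracted is the value at `0` of
the analytic factor, because the sum is empty for `u = 0`. -/
theorem exists_twistedSum [IsUltrametricDist K] [CompleteSpace K] (hg : AnalyticWith B g)
    (p : ℕ) [Fact p.Prime] [NormedAlgebra ℚ_[p] K] {N : ℕ} (hN : p.Coprime N)
    (hanti : Antitone B) (hB : Tendsto (fun l : ℕ => ((l : ℝ) + 1) * B l) atTop (𝓝 0))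
    {q : K} (hq : q ^ N = 1) :
    ∃ h : ℕ → K, AnalyticWith (sumBound p B) h ∧
      ∀ u : ℕ, ∑ v ∈ Finset.range u, q ^ v * g v = q ^ u * h u - h 0 := by
  obtain ⟨β, hβ, hs⟩ := hg
  have hB0 : ∀ l, 0 ≤ B l := fun l => (norm_nonneg _).trans (hβ l)
  have hq0 : q ≠ 0 := by
    rintro rfl
    rcases eq_or_ne N 0 with rfl | h
    · exact (Fact.out : p.Prime).one_lt.ne' (by simpa using hN)
    · simp [h] at hq
  choose P hP0 hP1 hP2 hP3 using fun l => exists_twistedSum_coeff p hN hq l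
  have hp1 : (1 : ℝ) ≤ p := by exact_mod_cast (Fact.out : p.Prime).one_le
  have hD : Tendsto (fun l : ℕ => (p : ℝ) * (((l : ℝ) + 1) * B l)) atTop (𝓝 0) := by
    simpa using hB.const_mul (p : ℝ)
  have hPD : ∀ l m, ‖β l * P l m‖ ≤ p * (((l : ℝ) + 1) * B l) := by
    intro l m
    rw [norm_mul, show (p : ℝ) * (((l : ℝ) + 1) * B l) = B l * (p * ((l : ℝ) + 1)) by ring]
    refine mul_le_mul (hβ l) ?_ (norm_nonneg _) (hB0 l)
    rcases eq_or_ne m 0 with rfl | hm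
    · refine (hP0 l).trans ?_
      have : (0 : ℝ) ≤ l := by positivity
      nlinarith
    · by_cases hlm : l + 1 < m
      · rw [hP2 l m hlm, norm_zero]; positivity
      · refine (hP1 l m hm).trans (mul_le_mul_of_nonneg_left ?_ (by positivity))
        exact_mod_cast not_lt.1 hlm
  have hsum0 : Summable fun l => β l * P l 0 :=
    summable_of_norm_le_of_tendsto hD fun l => hPD l 0
  refine ⟨fun u => (q ^ u)⁻¹ * (∑ v ∈ Finset.range u, q ^ v * g v + ∑' l, β l * P l 0),
    ⟨fun m => ∑' l, β l * P l m, fun m => ?_, fun u => ?_⟩, fun u => ?_⟩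
  · cases m with
    | zero =>
      refine IsUltrametricDist.norm_tsum_le_of_forall_le_of_nonneg (hB0 0) fun l => ?_
      rw [norm_mul]
      exact (mul_le_of_le_one_right (norm_nonneg _) (hP0 l)).trans
        ((hβ l).trans (hanti (Nat.zero_le l)))
    | succ m =>
      have hnn : 0 ≤ sumBound p B (m + 1) := by
        have := hB0 m
        simp only [sumBound]; positivity
      refine IsUltrametricDist.norm_tsum_le_of_forall_le_of_nonneg hnn fun l => ?_
      by_cases hlm : l < m
      · rw [hP2 l (m + 1) (by omega), mul_zero, norm_zero]
        exact hnn
      · rw [norm_mul, sumBound, mul_comm]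
        refine mul_le_mul ?_ ((hβ l).trans (hanti (not_lt.1 hlm))) (norm_nonneg _)
          (by positivity)
        exact_mod_cast hP1 l (m + 1) (Nat.succ_ne_zero m)
  · refine hasSum_rearrange hD hPD hP2 (norm_natCast_le p u) ?_
    have h1 : HasSum (fun l => ∑ v ∈ Finset.range u, q ^ v * (β l * (v : K) ^ l))
        (∑ v ∈ Finset.range u, q ^ v * g v) :=
      hasSum_sum fun v _ => (hs v).mul_left (q ^ v)
    refine ((h1.add hsum0.hasSum).mul_left (q ^ u)⁻¹).congr_fun fun l => ?_
    have h2 := hP3 l u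
    have hqu := pow_ne_zero u hq0
    rw [show ∑ v ∈ Finset.range u, q ^ v * (β l * (v : K) ^ l) =
      β l * ∑ v ∈ Finset.range u, q ^ v * (v : K) ^ l by
        rw [Finset.mul_sum]; exact Finset.sum_congr rfl fun v _ => by ring, h2]
    field_simp
    ring
  · have hqu := pow_ne_zero u hq0
    simp only [Finset.range_zero, Finset.sum_empty, pow_zero, inv_one, one_mul, zero_add]
    field_simp
    ring

end AnalyticWith

end AnalyticWith

/-! ### Exponential-analytic functions -/

/-- Functions `f` on `ℕ` of the form `f u = ∑_{i < N} η ^ (i u) g_i(u)`, where the `g_i` are sums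
of power series with coefficients bounded by `B`. -/
def ExpAnalytic {K : Type*} [NormedField K] (N : ℕ) (η : K) (B : ℕ → ℝ) (f : ℕ → K) : Prop :=
  ∃ g : Fin N → ℕ → K, (∀ i, AnalyticWith B (g i)) ∧
    ∀ u, f u = ∑ i : Fin N, η ^ ((i : ℕ) * u) * g i u

theorem sumBound_nonneg (p : ℕ) {B : ℕ → ℝ} (hB : ∀ l, 0 ≤ B l) (l : ℕ) : 0 ≤ sumBound p B l := by
  cases l with
  | zero => exact hB 0
  | succ l => have := hB l; simp only [sumBound]; positivity

namespace ExpAnalytic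

variable {K : Type*} [NormedField K] {N : ℕ} {η : K} {B C : ℕ → ℝ} {f : ℕ → K}

theorem mono (hBC : ∀ l, B l ≤ C l) (hf : ExpAnalytic N η B f) : ExpAnalytic N η C f := by
  obtain ⟨g, hg, hfg⟩ := hf
  exact ⟨g, fun i => (hg i).mono hBC, hfg⟩

theorem const (hN : N ≠ 0) (hB : ∀ l, 0 ≤ B l) {a : K} (ha : ‖a‖ ≤ B 0) :
    ExpAnalytic N η B fun _ => a := by
  obtain ⟨M, rfl⟩ := Nat.exists_eq_succ_of_ne_zero hN
  refine ⟨fun i => if i = 0 then fun _ => a else fun _ => 0, fun i => ?_, fun u => ?_⟩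
  · by_cases h : i = 0
    · simpa only [h, if_true] using AnalyticWith.const hB ha
    · simpa only [h, if_false] using AnalyticWith.zero hB
  · rw [Finset.sum_eq_single 0 (fun i _ hi => by simp [hi]) (by simp)]
    simp

theorem const_mul (hf : ExpAnalytic N η B f) {a : K} (ha : ‖a‖ ≤ 1) (hB : ∀ l, 0 ≤ B l) :
    ExpAnalytic N η B fun u => a * f u := by
  obtain ⟨g, hg, hfg⟩ := hf
  refine ⟨fun i u => a * g i u, fun i => ((hg i).const_mul a).mono fun l =>
    mul_le_of_le_one_left (hB l) ha, fun u => ?_⟩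
  simp only [hfg]
  rw [Finset.mul_sum]
  exact Finset.sum_congr rfl fun i _ => by ring

theorem add [IsUltrametricDist K] {h : ℕ → K} (hf : ExpAnalytic N η B f)
    (hh : ExpAnalytic N η B h) : ExpAnalytic N η B fun u => f u + h u := by
  obtain ⟨g, hg, hfg⟩ := hf
  obtain ⟨k, hk, hhk⟩ := hh
  refine ⟨fun i u => g i u + k i u, fun i => (hg i).add (hk i), fun u => ?_⟩
  simp only [hfg, hhk]
  rw [← Finset.sum_add_distrib]
  exact Finset.sum_congr rfl fun i _ => by ring

theorem sum [IsUltrametricDist K] (hN : N ≠ 0) (hB : ∀ l, 0 ≤ B l) {ι : Type*} (s : Finset ι)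
    {F : ι → ℕ → K} (hF : ∀ j ∈ s, ExpAnalytic N η B (F j)) :
    ExpAnalytic N η B fun u => ∑ j ∈ s, F j u := by
  classical
  induction s using Finset.induction_on with
  | empty => simpa using const hN hB (a := (0 : K)) (by simpa using hB 0)
  | insert j s hj ih =>
    simp only [Finset.sum_insert hj]
    exact (hF j (Finset.mem_insert_self j s)).add
      (ih fun k hk => hF k (Finset.mem_insert_of_mem hk))

/-- Multiplication by a character permutes the components. -/
theorem char_mul (hN : N ≠ 0) (hη : η ^ N = 1) (hf : ExpAnalytic N η B f) (j : ℕ) :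
    ExpAnalytic N η B fun u => η ^ (j * u) * f u := by
  obtain ⟨g, hg, hfg⟩ := hf
  have : NeZero N := ⟨hN⟩
  refine ⟨fun i => g (i - Fin.ofNat N j), fun i => hg _, fun u => ?_⟩
  simp only [hfg]
  rw [Finset.mul_sum]
  refine Fintype.sum_equiv (Equiv.addRight (Fin.ofNat N j)) _ _ fun i => ?_
  simp only [Equiv.coe_addRight, add_sub_cancel_right]
  have hper : ∀ a : ℕ, η ^ (a * u) = η ^ (a % N * u) := fun a => by
    rw [pow_mul, pow_mul, ← pow_mod_orderOf η a, ← pow_mod_orderOf η (a % N),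
      Nat.mod_mod_of_dvd a (orderOf_dvd_of_pow_eq_one hη)]
  rw [← mul_assoc, ← pow_add, ← add_mul, hper, Fin.val_add, Fin.val_ofNat, Nat.add_mod_mod,
    add_comm j]

theorem norm_zero_le [IsUltrametricDist K] (hf : ExpAnalytic N η B f) (hB : ∀ l, 0 ≤ B l) :
    ‖f 0‖ ≤ B 0 := by
  obtain ⟨g, hg, hfg⟩ := hf
  rw [hfg]
  refine IsUltrametricDist.norm_sum_le_of_forall_le_of_nonneg (hB 0) fun i _ => ?_
  obtain ⟨β, hβ, hs⟩ := hg i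
  have h0 : HasSum (fun l => β l * ((0 : ℕ) : K) ^ l) (β 0 * ((0 : ℕ) : K) ^ 0) :=
    hasSum_single 0 fun l hl => by simp [hl]
  rw [mul_zero, pow_zero, one_mul, (hs 0).unique h0, pow_zero, mul_one]
  exact hβ 0

variable [IsUltrametricDist K] [CompleteSpace K] (p : ℕ) [Fact p.Prime] [NormedAlgebra ℚ_[p] K]

theorem le_sumBound (hB : ∀ l, 0 ≤ B l) (hanti : Antitone B) (l : ℕ) : B l ≤ sumBound p B l := by
  cases l with
  | zero => exact le_rfl
  | succ l =>
    refine (hanti (Nat.le_succ l)).trans (le_mul_of_one_le_left (hB l) ?_)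
    have h1 : (1 : ℝ) ≤ p := by exact_mod_cast (Fact.out : p.Prime).one_le
    have h2 : (0 : ℝ) ≤ l := by positivity
    nlinarith

/-- On the component of the character `η ^ i`, the partial sums are twisted by `q = η ^ i`; the
constants of integration go into the component of the trivial character. -/
theorem partialSum (hN : p.Coprime N) (hη : η ^ N = 1) (hB0 : ∀ l, 0 ≤ B l) (hanti : Antitone B)
    (hB : Tendsto (fun l : ℕ => ((l : ℝ) + 1) * B l) atTop (𝓝 0))
    (hf : ExpAnalytic N η B f) :
    ExpAnalytic N η (sumBound p B) fun u => ∑ v ∈ Finset.range u, f v := by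
  have hN0 := ne_zero_of_coprime p hN
  obtain ⟨g, hg, hfg⟩ := hf
  choose h hh hsum using fun i : Fin N => (hg i).exists_twistedSum p hN hanti hB
    (q := η ^ (i : ℕ)) (by rw [← pow_mul, mul_comm, pow_mul, hη, one_pow])
  have h1 : ExpAnalytic N η (sumBound p B) fun u => ∑ i : Fin N, η ^ ((i : ℕ) * u) * h i u :=
    ⟨h, hh, fun _ => rfl⟩
  have h2 : ‖-∑ i : Fin N, h i 0‖ ≤ sumBound p B 0 := by
    rw [norm_neg]
    simpa using h1.norm_zero_le (sumBound_nonneg p hB0)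
  convert h1.add (const hN0 (sumBound_nonneg p hB0) h2) using 2 with u
  simp only [hfg]
  rw [Finset.sum_comm, ← sub_eq_add_neg, ← Finset.sum_sub_distrib]
  refine Finset.sum_congr rfl fun i _ => ?_
  rw [pow_mul, ← hsum]
  exact Finset.sum_congr rfl fun v _ => by rw [pow_mul]

/-- Division by `(p ^ α u + r) / p ^ α` with `r` not divisible by `p ^ α`. -/
theorem mul_div_add {α r : ℕ} (hr : ¬ p ^ α ∣ r) (hf : ExpAnalytic N η B f)
    (hBC : ∀ l, B l ≤ p * C l) (hCC : ∀ l, (p : ℝ)⁻¹ * C l ≤ C (l + 1))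
    (hC : Tendsto C atTop (𝓝 0)) :
    ExpAnalytic N η C fun u => (p : K) ^ α * f u / ((p ^ α * u + r : ℕ) : K) := by
  have := charZero_of_algebra p K
  have hp : (0 : ℝ) < p := by exact_mod_cast (Fact.out : p.Prime).pos
  have hr0 : (r : K) ≠ 0 := by
    have : r ≠ 0 := by rintro rfl; simp at hr
    exact_mod_cast this
  obtain ⟨g, hg, hfg⟩ := hf
  choose h hh hmul using fun i : Fin N => (hg i).exists_mul_eq (C := fun l => p * C l) p hBC
    (fun l => by
      have := mul_le_mul_of_nonneg_left (hCC l) hp.le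
      linarith) (by simpa using hC.const_mul (p : ℝ))
    (t := -((p : K) ^ α / (r : K))) (by rw [norm_neg]; exact norm_pow_div_natCast_le p hr)
  refine ⟨fun i u => (p : K) ^ α / r * h i u, fun i => ?_, fun u => ?_⟩
  · have h1 := hh i
    obtain ⟨β, hβ, -⟩ := id h1
    refine (h1.const_mul _).mono fun l => ?_
    refine (mul_le_mul_of_nonneg_right (norm_pow_div_natCast_le p hr)
      ((norm_nonneg _).trans (hβ l))).trans (le_of_eq ?_)
    rw [← mul_assoc, inv_mul_cancel₀ hp.ne', one_mul]
  · have hne : ((p ^ α * u + r : ℕ) : K) ≠ 0 := by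
      have : p ^ α * u + r ≠ 0 := by
        intro h0; rw [show r = 0 by omega] at hr; simp at hr
      exact_mod_cast this
    rw [div_eq_iff hne, hfg, Finset.mul_sum, Finset.sum_mul]
    refine Finset.sum_congr rfl fun i _ => ?_
    rw [← hmul i u]
    push_cast
    field_simp
    ring

end ExpAnalytic

/-! ### Exponential-analytic sequences on the classes modulo `p ^ α` -/

section ClassAnalytic

variable (p : ℕ) {K : Type*} [NormedField K] (N α : ℕ) (ξ : K)

/-- The sequence `c` is exponential-analytic with bounds `B` on each class modulo `p ^ α`, in terms
of the variable `u` with `n = p ^ α u + r`. -/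
def ClassAnalytic (B : ℕ → ℝ) (c : ℕ → K) : Prop :=
  ∀ r < p ^ α, ExpAnalytic N (ξ ^ p ^ α)⁻¹ B fun u => c (p ^ α * u + r)

end ClassAnalytic

namespace ClassAnalytic

variable {p : ℕ} [Fact p.Prime] {K : Type*} [NormedField K] [NormedAlgebra ℚ_[p] K]
  [IsUltrametricDist K] [CompleteSpace K] {N α : ℕ} {ξ : K} {B C : ℕ → ℝ} {c : ℕ → K}

/-- Splitting a sum over `m < k u` into the residue classes modulo `k`. -/
theorem sum_range_block {M : Type*} [AddCommMonoid M] (f : ℕ → M) (k u : ℕ) :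
    ∑ m ∈ Finset.range (k * u), f m =
      ∑ v ∈ Finset.range u, ∑ r ∈ Finset.range k, f (k * v + r) := by
  induction u with
  | zero => simp
  | succ u ih => rw [Nat.mul_succ, Finset.sum_range_add, ih, Finset.sum_range_succ]

/-- The coefficients of the product of a power series with `z / (z - ξ ^ j)`; the value of `c` at
`0` is replaced by `0`. -/
theorem twistedPartialSum (hN : p.Coprime N) (hξ : ξ ^ N = 1) (hB0 : ∀ l, 0 ≤ B l)
    (hanti : Antitone B) (hB : Tendsto (fun l : ℕ => ((l : ℝ) + 1) * B l) atTop (𝓝 0))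
    (hc : ClassAnalytic p N α ξ B c) (j : ℕ) :
    ClassAnalytic p N α ξ (sumBound p B) fun n =>
      -(ξ ^ (j * n))⁻¹ * (∑ m ∈ Finset.range n, ξ ^ (j * m) * c m - c 0) := by
  intro r hr
  have hp := (Fact.out : p.Prime)
  have hN0 := ne_zero_of_coprime p hN
  have hξ0 : ξ ≠ 0 := by rintro rfl; simp [hN0] at hξ
  have hξn : ‖ξ‖ = 1 := norm_of_pow_eq_one hN0 hξ
  set η : K := (ξ ^ p ^ α)⁻¹ with hη
  have hηN : η ^ N = 1 := by rw [hη, inv_pow, ← pow_mul, mul_comm, pow_mul, hξ, one_pow, inv_one]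
  -- `ξ ^ (j p ^ α u)` is a character of `u` with a nonnegative exponent of `η`.
  have hη1 : ξ ^ p ^ α = η ^ (N - 1) := by
    have : η ^ (N - 1) * η = 1 := by rw [← pow_succ, Nat.sub_add_cancel (by omega), hηN]
    rw [eq_inv_of_mul_eq_one_left this, hη, inv_inv]
  have hS0 := sumBound_nonneg p hB0
  have hle := ExpAnalytic.le_sumBound p hB0 hanti
  -- For `n = p ^ α u + r`, the sum over `m < n` splits into complete blocks `p ^ α v + r'` with
  -- `v < u`, and the terms `p ^ α u + r'` with `r' < r`.
  have hterm : ∀ r' ∈ Finset.range (p ^ α), ExpAnalytic N η B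
      fun u => ξ ^ (j * (p ^ α * u + r')) * c (p ^ α * u + r') := by
    intro r' hr'
    have h1 := ((hc r' (Finset.mem_range.1 hr')).char_mul hN0 hηN ((N - 1) * j)).const_mul
      (a := ξ ^ (j * r')) (by rw [norm_pow, hξn, one_pow]) hB0
    convert h1 using 2 with u
    rw [mul_assoc (N - 1), pow_mul η, ← hη1, ← mul_assoc, ← pow_mul, ← pow_add]
    congr 2
    ring
  have h1 := (ExpAnalytic.sum hN0 hB0 _ hterm).partialSum p hN hηN hB0 hanti hB
  have h2 := (ExpAnalytic.sum hN0 hB0 (Finset.range r) fun r' hr' =>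
    hterm r' (Finset.mem_range.2 ((Finset.mem_range.1 hr').trans hr))).mono hle
  have h3 : ExpAnalytic N η (sumBound p B) fun _ => -c 0 := by
    refine ExpAnalytic.const hN0 hS0 ?_
    rw [norm_neg]
    exact (by simpa using (hc 0 (pow_pos hp.pos α)).norm_zero_le hB0 : ‖c 0‖ ≤ B 0)
  have h4 := (((h1.add h2).add h3).char_mul hN0 hηN j).const_mul (a := -(ξ ^ (j * r))⁻¹)
    (by rw [norm_neg, norm_inv, norm_pow, hξn, one_pow, inv_one]) hS0
  convert h4 using 2 with u
  beta_reduce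
  rw [Finset.sum_range_add, sum_range_block, ← mul_assoc, sub_eq_add_neg]
  congr 1
  rw [hη, inv_pow, ← pow_mul, neg_mul, ← mul_inv, ← pow_add]
  congr 3
  ring

/-- Multiplication by `p ^ α / n` produces a polar part, and after its removal a sequence that is
exponential-analytic on each class. -/
theorem exists_regularization (hξ0 : ξ ≠ 0) (hc : ClassAnalytic p N α ξ B c)
    (hBC : ∀ l, B l ≤ p * C l) (hBC' : ∀ l, B (l + 1) ≤ C l)
    (hCC : ∀ l, (p : ℝ)⁻¹ * C l ≤ C (l + 1)) (hC : Tendsto C atTop (𝓝 0)) :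
    ∃ (a : Fin N → K) (c' : ℕ → K), ClassAnalytic p N α ξ C c' ∧ ∀ n, n ≠ 0 →
      (p : K) ^ α * c n / n = c' n + ∑ i : Fin N, a i * polarSeq p N α ξ i n := by
  have hp := (Fact.out : p.Prime)
  have hpα : 0 < p ^ α := pow_pos hp.pos α
  have := charZero_of_algebra p K
  obtain ⟨g, hg, hfg⟩ := hc 0 hpα
  choose a h hh hgh using fun i : Fin N => (hg i).exists_eq_add_mul p hBC' hC
  refine ⟨fun i => (p : K) ^ α * a i, fun n => if p ^ α ∣ n then
    ∑ i : Fin N, (ξ ^ p ^ α)⁻¹ ^ ((i : ℕ) * (n / p ^ α)) * h i (n / p ^ α)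
    else (p : K) ^ α * c n / n, fun r hr => ?_, fun n hn => ?_⟩
  · rcases eq_or_ne r 0 with rfl | hr0
    · refine ⟨h, hh, fun u => ?_⟩
      simp [Nat.mul_div_cancel_left _ hpα]
    · have hdvd : ¬ p ^ α ∣ r := Nat.not_dvd_of_pos_of_lt (Nat.pos_of_ne_zero hr0) hr
      have hdvd' : ∀ u, ¬ p ^ α ∣ p ^ α * u + r := fun u h =>
        hdvd ((Nat.dvd_add_right (dvd_mul_right _ _)).1 h)
      simp only [hdvd', if_false]
      exact (hc r hr).mul_div_add p hdvd hBC hCC hC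
  · by_cases hd : p ^ α ∣ n
    · obtain ⟨u, rfl⟩ := hd
      have hu : (u : K) ≠ 0 := by
        have : u ≠ 0 := by rintro rfl; simp at hn
        exact_mod_cast this
      have hpK : (p : K) ≠ 0 := by exact_mod_cast hp.ne_zero
      have := hfg u
      simp only [add_zero] at this
      simp only [polarSeq, dvd_mul_right, if_true, Nat.mul_div_cancel_left _ hpα]
      rw [this, ← Finset.sum_add_distrib, Finset.mul_sum, Finset.sum_div]
      refine Finset.sum_congr rfl fun i _ => ?_
      rw [hgh i u, inv_pow, ← pow_mul, show p ^ α * ((i : ℕ) * u) = (i : ℕ) * (p ^ α * u) by ring]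
      push_cast
      field_simp
      ring
    · simp [polarSeq, hd]

end ClassAnalytic

/-! ### Growth of the coefficients -/

section Tame

/-- Bounds `C l ≤ p ^ (κ + (κ' / log p) log (l + κ'') - l)`: after the substitution
`n - n₀ = p ^ α u` these are the bounds that define the space `S_α`. -/
def Tame (p : ℕ) (C : ℕ → ℝ) : Prop :=
  ∃ κ κ' κ'' : ℝ, 0 < κ ∧ 0 < κ' ∧ 0 < κ'' ∧ ∀ l : ℕ,
    C l ≤ (p : ℝ) ^ (κ + κ' / Real.log p * Real.log (l + κ'') - l)

/-- The bounds are, up to a constant, a power of `l` times `p ^ (-l)`. -/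
theorem Tame.summable_succ_mul {p : ℕ} (hp : p.Prime) {C : ℕ → ℝ} (hC : Tame p C)
    (hC0 : ∀ l, 0 ≤ C l) : Summable fun l : ℕ => ((l : ℝ) + 1) * C l := by
  obtain ⟨κ, κ', κ'', hκ, hκ', hκ'', h⟩ := hC
  have hp1 : (1 : ℝ) < p := by exact_mod_cast hp.one_lt
  have hp0 : (0 : ℝ) < p := by linarith
  have hlog : 0 < Real.log p := Real.log_pos hp1
  obtain ⟨k, hk⟩ := exists_nat_ge κ'
  set M : ℝ := max 1 κ'' with hM
  have hM1 : 1 ≤ M := le_max_left _ _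
  have hgeom := summable_pow_mul_geometric_of_norm_lt_one (k + 1) (r := (p : ℝ)⁻¹)
    (by rw [Real.norm_of_nonneg (by positivity)]; exact inv_lt_one_of_one_lt₀ hp1)
  have hgeom' := ((summable_nat_add_iff 1).2 hgeom).mul_left ((p : ℝ) ^ κ * M ^ k * p)
  refine Summable.of_nonneg_of_le (fun l => mul_nonneg (by positivity) (hC0 l)) (fun l => ?_) hgeom'
  have hy : 0 < (l : ℝ) + κ'' := by positivity
  have h1 : (p : ℝ) ^ (κ' / Real.log p * Real.log (l + κ'')) = ((l : ℝ) + κ'') ^ κ' := by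
    rw [Real.rpow_def_of_pos hp0, Real.rpow_def_of_pos hy]
    congr 1
    field_simp
  have h2 : ((l : ℝ) + κ'') ^ κ' ≤ (((l : ℝ) + 1) * M) ^ k := by
    have hle : (l : ℝ) + κ'' ≤ ((l : ℝ) + 1) * M := by
      have h3 : κ'' ≤ M := le_max_right _ _
      have h4 : (0 : ℝ) ≤ l := by positivity
      nlinarith
    have hone : 1 ≤ ((l : ℝ) + 1) * M := by
      have h4 : (0 : ℝ) ≤ l := by positivity
      nlinarith
    calc ((l : ℝ) + κ'') ^ κ' ≤ (((l : ℝ) + 1) * M) ^ κ' :=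
          Real.rpow_le_rpow hy.le hle hκ'.le
      _ ≤ (((l : ℝ) + 1) * M) ^ (k : ℝ) := Real.rpow_le_rpow_of_exponent_le hone hk
      _ = _ := Real.rpow_natCast _ _
  have h3 : C l ≤ (p : ℝ) ^ κ * (((l : ℝ) + 1) * M) ^ k * (p : ℝ)⁻¹ ^ l := by
    refine (h l).trans ?_
    rw [Real.rpow_sub hp0, Real.rpow_add hp0, h1, Real.rpow_natCast, div_eq_mul_inv, inv_pow]
    gcongr
  calc ((l : ℝ) + 1) * C l ≤ ((l : ℝ) + 1) *
        ((p : ℝ) ^ κ * (((l : ℝ) + 1) * M) ^ k * (p : ℝ)⁻¹ ^ l) := by gcongr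
    _ = _ := by
      push_cast
      rw [mul_pow, pow_succ (p : ℝ)⁻¹, pow_succ ((l : ℝ) + 1)]
      field_simp

theorem Tame.tendsto_succ_mul {p : ℕ} (hp : p.Prime) {C : ℕ → ℝ} (hC : Tame p C)
    (hC0 : ∀ l, 0 ≤ C l) : Tendsto (fun l : ℕ => ((l : ℝ) + 1) * C l) atTop (𝓝 0) :=
  (hC.summable_succ_mul hp hC0).tendsto_atTop_zero

theorem Tame.summable {p : ℕ} (hp : p.Prime) {C : ℕ → ℝ} (hC : Tame p C) (hC0 : ∀ l, 0 ≤ C l) :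
    Summable C :=
  Summable.of_nonneg_of_le hC0 (fun l => le_mul_of_one_le_left (hC0 l)
    (by have : (0 : ℝ) ≤ l := by positivity
        linarith)) (hC.summable_succ_mul hp hC0)

theorem Tame.isInS {p α : ℕ} (hp : p.Prime) {K : Type*} [NormedField K] {C : ℕ → ℝ}
    (hC : Tame p C) {b : ℕ → K} (hb : ∀ l, ‖b l‖ ≤ C l * (p : ℝ) ^ (α * l)) : IsInS p α b := by
  obtain ⟨κ, κ', κ'', hκ, hκ', hκ'', h⟩ := hC
  have hp0 : (0 : ℝ) < p := by exact_mod_cast hp.pos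
  refine ⟨κ, κ', κ'', hκ, hκ', hκ'', fun l => (hb l).trans ?_⟩
  calc C l * (p : ℝ) ^ (α * l)
      ≤ (p : ℝ) ^ (κ + κ' / Real.log p * Real.log (l + κ'') - l) * (p : ℝ) ^ (α * l) := by
        gcongr; exact h l
    _ = _ := by
        rw [← Real.rpow_natCast, ← Real.rpow_add hp0]
        congr 1
        push_cast
        ring

end Tame

/-! ### Expansions at arbitrary centres -/

/-- A power series in `u` with bounds `B` is a power series in `u - t` with the same bounds,
for all `t` with `|t| ≤ 1`. -/
theorem AnalyticWith.exists_translate {K : Type*} [NormedField K] [IsUltrametricDist K]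
    [CompleteSpace K] {B : ℕ → ℝ} {g : ℕ → K} (hg : AnalyticWith B g)
    (p : ℕ) [Fact p.Prime] [NormedAlgebra ℚ_[p] K]
    (hanti : Antitone B) (hB : Tendsto B atTop (𝓝 0)) {t : K} (ht : ‖t‖ ≤ 1) :
    ∃ γ : ℕ → K, (∀ l, ‖γ l‖ ≤ B l) ∧ ∀ u : ℕ, HasSum (fun l => γ l * ((u : K) - t) ^ l) (g u) := by
  obtain ⟨β, hβ, hs⟩ := hg
  have hB0 : ∀ l, 0 ≤ B l := fun l => (norm_nonneg _).trans (hβ l)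
  let P : ℕ → ℕ → K := fun l m => if m ≤ l then t ^ (l - m) * (l.choose m : K) else 0
  have hP1 : ∀ l m, ‖P l m‖ ≤ 1 := by
    intro l m
    simp only [P]
    split_ifs
    · rw [norm_mul, norm_pow]
      exact mul_le_one₀ (pow_le_one₀ (norm_nonneg _) ht) (norm_nonneg _) (norm_natCast_le p _)
    · simp
  have hPB : ∀ l m, ‖β l * P l m‖ ≤ B l := fun l m => by
    rw [norm_mul]
    exact (mul_le_of_le_one_right (norm_nonneg _) (hP1 l m)).trans (hβ l)
  refine ⟨fun m => ∑' l, β l * P l m, fun m => ?_, fun u => ?_⟩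
  · refine IsUltrametricDist.norm_tsum_le_of_forall_le_of_nonneg (hB0 m) fun l => ?_
    by_cases hlm : m ≤ l
    · exact (hPB l m).trans (hanti hlm)
    · simpa [P, hlm] using hB0 m
  · refine hasSum_rearrange hB hPB (fun l m h => if_neg (by omega)) ?_ ?_
    · exact (norm_sub_le_max _ _).trans (max_le (norm_natCast_le p u) ht)
    · refine (hs u).congr_fun fun l => ?_
      rw [Finset.sum_range_succ, show P l (l + 1) = 0 from if_neg (by omega), zero_mul, add_zero]
      congr 1
      rw [show (u : K) ^ l = (((u : K) - t) + t) ^ l by ring, add_pow]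
      refine Finset.sum_congr rfl fun m hm => ?_
      rw [show P l m = t ^ (l - m) * (l.choose m : K) from
        if_pos (by have := Finset.mem_range.1 hm; omega)]
      ring

section Expansions

variable {p : ℕ} [Fact p.Prime]

theorem exists_eq_add_mul_of_norm_sub_le {α : ℕ} {x y : ℤ_[p]}
    (h : ‖x - y‖ ≤ (p : ℝ) ^ (-(α : ℤ))) : ∃ t : ℤ_[p], x = y + (p : ℤ_[p]) ^ α * t := by
  rw [PadicInt.norm_le_pow_iff_mem_span_pow, Ideal.mem_span_singleton] at h
  obtain ⟨t, ht⟩ := h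
  exact ⟨t, by rw [← ht]; ring⟩

theorem exists_eq_mul_add_of_norm_sub_le {α n r : ℕ} (hr : r < p ^ α)
    (h : ‖(n : ℤ_[p]) - r‖ ≤ (p : ℝ) ^ (-(α : ℤ))) : ∃ u, n = p ^ α * u + r := by
  have h1 : ((p ^ α : ℕ) : ℤ) ∣ (n : ℤ) - r := by
    have := (PadicInt.norm_int_le_pow_iff_dvd (p := p) (k := (n : ℤ) - r) (n := α)).1
      (by push_cast; exact h)
    exact_mod_cast this
  have h2 : n % p ^ α = r := by
    rw [← Nat.mod_eq_of_lt hr]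
    exact ((Nat.modEq_iff_dvd).2 h1).symm
  exact ⟨n / p ^ α, by rw [← h2, Nat.div_add_mod]⟩

theorem norm_sub_appr_le (α : ℕ) (x : ℤ_[p]) :
    ‖x - (x.appr α : ℤ_[p])‖ ≤ (p : ℝ) ^ (-(α : ℤ)) := by
  rw [PadicInt.norm_le_pow_iff_mem_span_pow]
  exact PadicInt.appr_spec α x

variable {K : Type*} [NormedField K] [NormedAlgebra ℚ_[p] K] {N α : ℕ} {ξ : K}

theorem IsExpansionAt.congr {c c' : ℕ → K} {n₀ : ℤ_[p]} {κ : ℕ → Fin N → K}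
    (h : IsExpansionAt p N α ξ c n₀ κ)
    (hcc : ∀ n : ℕ, 1 ≤ n → ‖(n : ℤ_[p]) - n₀‖ ≤ (p : ℝ) ^ (-(α : ℤ)) → c n = c' n) :
    IsExpansionAt p N α ξ c' n₀ κ :=
  ⟨h.1, fun n hn hn₀ => hcc n hn hn₀ ▸ h.2 n hn hn₀⟩

variable [IsUltrametricDist K] [CompleteSpace K] {C : ℕ → ℝ} {c : ℕ → K}

/-- Expansions at any centre `n₀` in the class of `r`. With `n₀ = r + p ^ α t`, one has
`n - n₀ = p ^ α (u - t)`, so that an expansion in powers of `u - t` is rescaled by `p ^ (-α l)`. -/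
theorem ClassAnalytic.exists_isExpansionAt (hξn : ‖ξ‖ = 1) (hc : ClassAnalytic p N α ξ C c)
    (hC : Tame p C) (hC0 : ∀ l, 0 ≤ C l) (hanti : Antitone C) {r : ℕ} (hr : r < p ^ α)
    {n₀ : ℤ_[p]} (hn₀ : ‖n₀ - r‖ ≤ (p : ℝ) ^ (-(α : ℤ))) :
    ∃ κ : ℕ → Fin N → K, (∀ l i, ‖κ l i‖ ≤ C l * (p : ℝ) ^ (α * l)) ∧
      IsExpansionAt p N α ξ c n₀ κ := by
  have hp := (Fact.out : p.Prime)
  have hp0 : (0 : ℝ) < p := by exact_mod_cast hp.pos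
  have := charZero_of_algebra p K
  have hpK : (p : K) ≠ 0 := by exact_mod_cast hp.ne_zero
  have hξ : ξ ≠ 0 := by rintro rfl; simp at hξn
  obtain ⟨t, ht⟩ := exists_eq_add_mul_of_norm_sub_le hn₀
  obtain ⟨g, hg, hfg⟩ := hc r hr
  have htn : ‖algebraMap ℚ_[p] K (t : ℚ_[p])‖ ≤ 1 := by
    rw [norm_algebraMap']; exact t.norm_le_one
  choose γ hγ hs using fun i => (hg i).exists_translate p hanti
    (hC.summable hp hC0).tendsto_atTop_zero htn
  have hnorm : ∀ l (i : Fin N), ‖γ i l * ξ ^ ((i : ℕ) * r) * ((p : K) ^ (α * l))⁻¹‖ ≤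
      C l * (p : ℝ) ^ (α * l) := by
    intro l i
    rw [norm_mul, norm_mul, norm_inv, norm_pow (p : K), norm_pow ξ, hξn, one_pow, mul_one,
      norm_prime, inv_pow, inv_inv]
    gcongr
    exact hγ i l
  refine ⟨fun l i => γ i l * ξ ^ ((i : ℕ) * r) * ((p : K) ^ (α * l))⁻¹, hnorm,
    fun i => hC.isInS hp fun l => hnorm l i, ?_⟩
  · intro n hn hnn
    have hnr : ‖(n : ℤ_[p]) - r‖ ≤ (p : ℝ) ^ (-(α : ℤ)) := by
      rw [show (n : ℤ_[p]) - r = (n - n₀) + (n₀ - r) by ring]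
      exact (IsUltrametricDist.norm_add_le_max _ _).trans (max_le hnn hn₀)
    obtain ⟨u, rfl⟩ := exists_eq_mul_add_of_norm_sub_le hr hnr
    have hsum := hasSum_sum (f := fun (i : Fin N) l => (ξ ^ p ^ α)⁻¹ ^ ((i : ℕ) * u) *
      (γ i l * ((u : K) - algebraMap ℚ_[p] K (t : ℚ_[p])) ^ l)) (s := Finset.univ)
      fun i _ => (hs i u).mul_left ((ξ ^ p ^ α)⁻¹ ^ ((i : ℕ) * u))
    rw [← hfg] at hsum
    refine hsum.congr_fun fun l => Finset.sum_congr rfl fun i _ => ?_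
    have hval : algebraMap ℚ_[p] K ((((p ^ α * u + r : ℕ) : ℤ_[p]) - n₀ : ℤ_[p]) : ℚ_[p]) =
        (p : K) ^ α * ((u : K) - algebraMap ℚ_[p] K (t : ℚ_[p])) := by
      rw [show (((p ^ α * u + r : ℕ) : ℤ_[p]) - n₀ : ℤ_[p]) = (p : ℤ_[p]) ^ α * (u - t) by
        rw [ht]; push_cast; ring]
      rw [PadicInt.coe_mul, PadicInt.coe_pow, PadicInt.coe_sub, PadicInt.coe_natCast,
        PadicInt.coe_natCast, map_mul, map_pow, map_sub, map_natCast, map_natCast]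
    have hξr := pow_ne_zero ((i : ℕ) * r) hξ
    have hξu := pow_ne_zero (p ^ α * ((i : ℕ) * u)) hξ
    rw [hval, mul_pow, ← pow_mul, inv_pow, ← pow_mul,
      show (i : ℕ) * (p ^ α * u + r) = p ^ α * ((i : ℕ) * u) + (i : ℕ) * r by ring, pow_add]
    field_simp

end Expansions

/-! ### Uniqueness of expansions -/

section Uniqueness

/-- At most geometric growth. -/
def GeomBounded {K : Type*} [NormedField K] (b : ℕ → K) : Prop :=
  ∃ A R : ℝ, 0 ≤ A ∧ 0 ≤ R ∧ ∀ l, ‖b l‖ ≤ A * R ^ l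

namespace GeomBounded

variable {K : Type*} [NormedField K] {b c : ℕ → K}

theorem add (hb : GeomBounded b) (hc : GeomBounded c) : GeomBounded fun l => b l + c l := by
  obtain ⟨A, R, hA, hR, h⟩ := hb
  obtain ⟨A', R', hA', hR', h'⟩ := hc
  refine ⟨A + A', max R R', by positivity, by positivity, fun l => (norm_add_le _ _).trans ?_⟩
  rw [add_mul]
  refine add_le_add ((h l).trans ?_) ((h' l).trans ?_)
  · gcongr; exact le_max_left _ _
  · gcongr; exact le_max_right _ _

theorem mul_pow (hb : GeomBounded b) (x y : K) : GeomBounded fun l => b l * x * y ^ l := by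
  obtain ⟨A, R, hA, hR, h⟩ := hb
  refine ⟨A * ‖x‖, R * ‖y‖, by positivity, by positivity, fun l => ?_⟩
  rw [norm_mul, norm_mul, norm_pow]
  calc _ ≤ A * R ^ l * ‖x‖ * ‖y‖ ^ l := by gcongr; exact h l
    _ = _ := by ring

theorem sub (hb : GeomBounded b) (hc : GeomBounded c) : GeomBounded fun l => b l - c l := by
  simpa [sub_eq_add_neg] using hb.add (hc.mul_pow (-1) 1)

theorem sum {ι : Type*} (s : Finset ι) {F : ι → ℕ → K} (hF : ∀ i ∈ s, GeomBounded (F i)) :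
    GeomBounded fun l => ∑ i ∈ s, F i l := by
  classical
  induction s using Finset.induction_on with
  | empty => exact ⟨0, 0, le_rfl, le_rfl, by simp⟩
  | insert j s hj ih =>
    simp only [Finset.sum_insert hj]
    exact (hF j (Finset.mem_insert_self j s)).add
      (ih fun k hk => hF k (Finset.mem_insert_of_mem hk))

theorem cons (hb : GeomBounded b) (a : K) :
    GeomBounded fun l => Nat.casesOn (motive := fun _ => K) l a b := by
  obtain ⟨A, R, hA, hR, h⟩ := hb
  refine ⟨‖a‖ + A, R + 1, by positivity, by positivity, fun l => ?_⟩
  cases l with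
  | zero => simpa using hA
  | succ l =>
    calc ‖b l‖ ≤ A * R ^ l := h l
      _ ≤ (‖a‖ + A) * (R + 1) ^ l := by
        gcongr
        · linarith [norm_nonneg a]
        · linarith
      _ ≤ (‖a‖ + A) * (R + 1) ^ (l + 1) := by
        gcongr
        · linarith
        · omega

/-- Isolated zeros: a power series that vanishes at a sequence of nonzero points tending to `0`
is zero. -/
theorem eq_zero_of_hasSum [IsUltrametricDist K] (hb : GeomBounded b) {x : ℕ → K}
    (hx0 : ∀ k, x k ≠ 0) (hx : Tendsto x atTop (𝓝 0))
    (hs : ∀ k, HasSum (fun l => b l * x k ^ l) 0) (m : ℕ) : b m = 0 := by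
  -- After division by `x_k ^ m`, the term `b m` is minus a sum of terms of size `O(|x_k|)`.
  induction m using Nat.strong_induction_on with
  | _ m ih =>
    obtain ⟨A, R, hA, hR, h⟩ := hb
    have hnorm : Tendsto (fun k => R * ‖x k‖) atTop (𝓝 0) := by
      simpa using hx.norm.const_mul R
    have hbound : ∀ᶠ k in atTop, ‖b m‖ ≤ A * R ^ m * (R * ‖x k‖) := by
      filter_upwards [hnorm.eventually (gt_mem_nhds one_pos)] with k hk
      have h1 := (hasSum_nat_add_iff' (m + 1)).2 (hs k)
      rw [Finset.sum_range_succ, Finset.sum_eq_zero (fun l hl => by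
        rw [ih l (Finset.mem_range.1 hl), zero_mul]), zero_add, zero_sub] at h1
      have hxm := pow_ne_zero m (hx0 k)
      have h2 := h1.mul_right (x k ^ m)⁻¹
      have h3 : ‖-(b m * x k ^ m) * (x k ^ m)⁻¹‖ ≤ A * R ^ m * (R * ‖x k‖) := by
        refine norm_le_of_hasSum h2 (by positivity) fun l => ?_
        rw [show b (l + (m + 1)) * x k ^ (l + (m + 1)) * (x k ^ m)⁻¹ =
          b (l + (m + 1)) * x k ^ (l + 1) by
            rw [show l + (m + 1) = (l + 1) + m by ring, pow_add (x k)]; field_simp,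
          norm_mul, norm_pow]
        calc _ ≤ A * R ^ (l + (m + 1)) * ‖x k‖ ^ (l + 1) := by gcongr; exact h _
          _ = A * R ^ m * (R * ‖x k‖) * (R * ‖x k‖) ^ l := by ring
          _ ≤ _ := mul_le_of_le_one_right (by positivity)
            (pow_le_one₀ (by positivity) hk.le)
      rwa [neg_mul, norm_neg, mul_assoc, mul_inv_cancel₀ hxm, mul_one] at h3
    have hlim := hnorm.const_mul (A * R ^ m)
    rw [mul_zero] at hlim
    exact norm_le_zero_iff.1 (ge_of_tendsto hlim hbound)

end GeomBounded

theorem IsInS.geomBounded {p α : ℕ} (hp : p.Prime) {K : Type*} [NormedField K] {b : ℕ → K}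
    (hb : IsInS p α b) : GeomBounded b := by
  obtain ⟨κ, κ', κ'', hκ, hκ', hκ'', h⟩ := hb
  have hp1 : (1 : ℝ) < p := by exact_mod_cast hp.one_lt
  have hp0 : (0 : ℝ) < p := by linarith
  have hlog : 0 < Real.log p := Real.log_pos hp1
  refine ⟨(p : ℝ) ^ (κ + κ' / Real.log p * κ''), (p : ℝ) ^ (κ' / Real.log p + (α - 1)),
    by positivity, by positivity, fun l => (h l).trans ?_⟩
  rw [← Real.rpow_natCast, ← Real.rpow_mul hp0.le, ← Real.rpow_add hp0]
  refine Real.rpow_le_rpow_of_exponent_le hp1.le ?_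
  have h1 : Real.log (l + κ'') ≤ l + κ'' :=
    (Real.log_le_sub_one_of_pos (by positivity)).trans (by linarith)
  have h2 := mul_le_mul_of_nonneg_left h1 (by positivity : 0 ≤ κ' / Real.log p)
  linarith

variable {p : ℕ} [Fact p.Prime] {K : Type*} [NormedField K] [NormedAlgebra ℚ_[p] K]
  [IsUltrametricDist K] {N : ℕ} {η : K}

/-- Uniqueness of analytic-exponential expansions. Along integers `u` in a fixed class `a` modulo
`N` that tend to `0` in `ℤ_p` the characters are constant, so the power series with coefficients
`∑_i δ l i η ^ (i a)` vanish; these relations for all `a` form a Vandermonde system. -/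
theorem eq_zero_of_hasSum_characters (hN : p.Coprime N) (hη : IsPrimitiveRoot η N)
    {δ : ℕ → Fin N → K} (hδ : ∀ i, GeomBounded fun l => δ l i) (y : K) (hy : y ≠ 0)
    (hs : ∀ u : ℕ, u ≠ 0 →
      HasSum (fun l => ∑ i : Fin N, δ l i * η ^ ((i : ℕ) * u) * (y * u) ^ l) 0)
    (l : ℕ) (i : Fin N) : δ l i = 0 := by
  have hp := (Fact.out : p.Prime)
  have := charZero_of_algebra p K
  have hN0 := ne_zero_of_coprime p hN
  have hφ : 0 < N.totient := Nat.totient_pos.2 (Nat.pos_of_ne_zero hN0)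
  have key : ∀ a l, ∑ i : Fin N, δ l i * η ^ ((i : ℕ) * a) = 0 := by
    intro a
    -- `p ^ (φ(N) k)` is congruent to `1` modulo `N` and tends to `0` in `ℤ_p`; the summand `N`
    -- makes the second factor nonzero.
    let u : ℕ → ℕ := fun k => p ^ (N.totient * k) * (a + N)
    have hu0 : ∀ k, u k ≠ 0 := fun k => by
      have := pow_pos hp.pos (N.totient * k)
      simp only [u]; positivity
    have hmod : ∀ k, u k ≡ a [MOD N] := by
      intro k
      have h1 : p ^ (N.totient * k) ≡ 1 [MOD N] := by
        rw [pow_mul]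
        simpa using (Nat.ModEq.pow_totient hN).pow k
      have h2 : a + N ≡ a [MOD N] := by simp [Nat.ModEq]
      simpa using h1.mul h2
    have hchar : ∀ k (i : ℕ), η ^ (i * u k) = η ^ (i * a) := by
      intro k i
      have h1 := (hmod k).mul_left i
      rw [← pow_mod_orderOf, ← pow_mod_orderOf η (i * a), ← hη.eq_orderOf]
      rw [h1]
    have hlim : Tendsto (fun k => y * (u k : K)) atTop (𝓝 0) := by
      have hpow : Tendsto (fun k : ℕ => (p : ℝ)⁻¹ ^ k) atTop (𝓝 0) :=
        tendsto_pow_atTop_nhds_zero_of_lt_one (by positivity)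
          (inv_lt_one_of_one_lt₀ (by exact_mod_cast hp.one_lt))
      have hz : Tendsto (fun k => (u k : K)) atTop (𝓝 0) := by
        refine squeeze_zero_norm (fun k => ?_) hpow
        simp only [u]
        rw [Nat.cast_mul, norm_mul, Nat.cast_pow, norm_pow, norm_prime]
        refine (mul_le_of_le_one_right (by positivity) (norm_natCast_le p _)).trans ?_
        refine pow_le_pow_of_le_one (by positivity)
          (inv_le_one_of_one_le₀ (by exact_mod_cast hp.one_le)) ?_
        exact Nat.le_mul_of_pos_left k hφ
      simpa using hz.const_mul y
    refine GeomBounded.eq_zero_of_hasSum (GeomBounded.sum _ fun i _ => by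
      simpa using (hδ i).mul_pow (η ^ ((i : ℕ) * a)) 1)
      (fun k => mul_ne_zero hy (by exact_mod_cast hu0 k)) hlim fun k => ?_
    refine (hs (u k) (hu0 k)).congr_fun fun l => ?_
    rw [Finset.sum_mul]
    exact Finset.sum_congr rfl fun i _ => by rw [hchar]
  have hinj : Function.Injective fun i : Fin N => η ^ (i : ℕ) := fun i j hij =>
    Fin.ext (hη.pow_inj i.2 j.2 hij)
  refine congrFun (Matrix.eq_zero_of_forall_pow_sum_mul_pow_eq_zero (v := δ l) hinj fun a => ?_) i
  rw [← key a l]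
  exact Finset.sum_congr rfl fun i _ => by rw [pow_mul]

end Uniqueness

/-! ### Regularization -/

section Regularization

theorem isPrimitiveRoot_inv_pow {K : Type*} [Field K] {p N α : ℕ} {ξ : K}
    (hN : p.Coprime N) (hξ : IsPrimitiveRoot ξ N) :
    IsPrimitiveRoot (ξ ^ p ^ α)⁻¹ N :=
  (hξ.pow_of_coprime _ (hN.pow_left α)).inv

variable {p : ℕ} [Fact p.Prime] {K : Type*} [NormedField K] [NormedAlgebra ℚ_[p] K]
  [IsUltrametricDist K] {N α : ℕ} {ξ : K}

theorem IsExpansionAt.unique (hN : p.Coprime N) (hξ : IsPrimitiveRoot ξ N) {c : ℕ → K} {r : ℕ}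
    {κ κ' : ℕ → Fin N → K} (h : IsExpansionAt p N α ξ c (r : ℤ_[p]) κ)
    (h' : IsExpansionAt p N α ξ c (r : ℤ_[p]) κ') (l : ℕ) (i : Fin N) : κ l i = κ' l i := by
  have hp := (Fact.out : p.Prime)
  have := charZero_of_algebra p K
  have hN0 := ne_zero_of_coprime p hN
  have hξ0 : ξ ≠ 0 := hξ.ne_zero hN0
  have hzero := eq_zero_of_hasSum_characters hN (isPrimitiveRoot_inv_pow (α := α) hN hξ)
    (δ := fun l i => (κ l i - κ' l i) * (ξ ^ ((i : ℕ) * r))⁻¹)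
    (fun i => by
      simpa using (((h.1 i).geomBounded hp).sub ((h'.1 i).geomBounded hp)).mul_pow
        (ξ ^ ((i : ℕ) * r))⁻¹ 1)
    ((p : K) ^ α) (pow_ne_zero _ (by exact_mod_cast hp.ne_zero)) (fun u hu => ?_) l i
  · have hr := inv_ne_zero (pow_ne_zero ((i : ℕ) * r) hξ0)
    exact sub_eq_zero.1 ((mul_eq_zero.1 hzero).resolve_right hr)
  · have hn : 1 ≤ p ^ α * u + r := by
      have := Nat.mul_pos (pow_pos hp.pos α) (Nat.pos_of_ne_zero hu)
      omega
    have hval : (((p ^ α * u + r : ℕ) : ℤ_[p]) - (r : ℤ_[p]) : ℤ_[p]) =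
        ((p ^ α * u : ℕ) : ℤ_[p]) := by push_cast; ring
    have hnorm : ‖((p ^ α * u + r : ℕ) : ℤ_[p]) - (r : ℤ_[p])‖ ≤ (p : ℝ) ^ (-(α : ℤ)) := by
      rw [hval, PadicInt.norm_le_pow_iff_mem_span_pow, Ideal.mem_span_singleton]
      exact ⟨u, by push_cast; ring⟩
    have hs := (h.2 _ hn hnorm).sub (h'.2 _ hn hnorm)
    rw [sub_self] at hs
    refine hs.congr_fun fun l => ?_
    rw [← Finset.sum_sub_distrib]
    refine Finset.sum_congr rfl fun i _ => ?_
    rw [hval, PadicInt.coe_natCast, map_natCast, inv_pow, ← pow_mul,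
      show (i : ℕ) * (p ^ α * u + r) = (i : ℕ) * r + p ^ α * ((i : ℕ) * u) by ring, pow_add,
      mul_inv]
    push_cast
    ring

/-- Uniqueness of the polar coefficients: after multiplication by `n`, they become the coefficients
of index `0` of a power series. -/
theorem IsLAEPolWith.unique (hN : p.Coprime N) (hξ : IsPrimitiveRoot ξ N) {c : ℕ → K}
    {a a' : Fin N → K} (h : IsLAEPolWith p N α ξ c a) (h' : IsLAEPolWith p N α ξ c a') :
    a = a' := by
  have hp := (Fact.out : p.Prime)
  have := charZero_of_algebra p K
  obtain ⟨κ, hκ⟩ := h.1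
  obtain ⟨κ', hκ'⟩ := h'.1
  funext i
  have hzero := eq_zero_of_hasSum_characters hN (isPrimitiveRoot_inv_pow (α := α) hN hξ)
    (δ := fun l i => Nat.casesOn (motive := fun _ => K) l (a i - a' i)
      fun l => κ l i - κ' l i)
    (fun i => (((hκ.1 i).geomBounded hp).sub ((hκ'.1 i).geomBounded hp)).cons _)
    ((p : K) ^ α) (pow_ne_zero _ (by exact_mod_cast hp.ne_zero)) (fun u hu => ?_) 0 i
  · exact sub_eq_zero.1 hzero
  · have hpu : 0 < p ^ α * u := Nat.mul_pos (pow_pos hp.pos α) (Nat.pos_of_ne_zero hu)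
    have hnorm : ‖((p ^ α * u : ℕ) : ℤ_[p]) - 0‖ ≤ (p : ℝ) ^ (-(α : ℤ)) := by
      rw [PadicInt.norm_le_pow_iff_mem_span_pow, Ideal.mem_span_singleton]
      exact ⟨u, by push_cast; ring⟩
    have hn0 : ((p ^ α * u : ℕ) : K) ≠ 0 := by exact_mod_cast hpu.ne'
    have hs := ((hκ.2 _ hpu hnorm).sub (hκ'.2 _ hpu hnorm)).mul_right ((p ^ α * u : ℕ) : K)
    rw [← hasSum_nat_add_iff' 1]
    have hval : (0 : K) - ∑ l ∈ Finset.range 1, ∑ i : Fin N,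
        (Nat.casesOn (motive := fun _ => K) l (a i - a' i) fun l => κ l i - κ' l i) *
          (ξ ^ p ^ α)⁻¹ ^ ((i : ℕ) * u) * ((p : K) ^ α * u) ^ l =
        (c (p ^ α * u) - ∑ i : Fin N, a i * (ξ ^ ((i : ℕ) * (p ^ α * u)))⁻¹ *
          ((p ^ α * u : ℕ) : K)⁻¹ - (c (p ^ α * u) - ∑ i : Fin N, a' i *
          (ξ ^ ((i : ℕ) * (p ^ α * u)))⁻¹ * ((p ^ α * u : ℕ) : K)⁻¹)) *
          ((p ^ α * u : ℕ) : K) := by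
      rw [Finset.range_one, Finset.sum_singleton, sub_sub_sub_cancel_left,
        ← Finset.sum_sub_distrib, Finset.sum_mul, zero_sub, ← Finset.sum_neg_distrib]
      refine Finset.sum_congr rfl fun i _ => ?_
      rw [inv_pow, ← pow_mul, show (i : ℕ) * (p ^ α * u) = p ^ α * ((i : ℕ) * u) by ring,
        pow_zero]
      change -((a i - a' i) * _ * 1) = _
      rw [← sub_mul, mul_assoc _ _ ((p ^ α * u : ℕ) : K), inv_mul_cancel₀ hn0]
      ring
    rw [hval]
    refine hs.congr_fun fun l => ?_
    rw [← Finset.sum_sub_distrib, Finset.sum_mul]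
    refine Finset.sum_congr rfl fun i _ => ?_
    rw [sub_zero, PadicInt.coe_natCast, map_natCast, inv_pow, ← pow_mul,
      show (i : ℕ) * (p ^ α * u) = p ^ α * ((i : ℕ) * u) by ring]
    push_cast
    ring

theorem polarCoeff_eq (hN : p.Coprime N) (hξ : IsPrimitiveRoot ξ N) {c : ℕ → K} {a : Fin N → K}
    (h : IsLAEPolWith p N α ξ c a) : polarCoeff p N α ξ c = a := by
  have hex : ∃ a, IsLAEPolWith p N α ξ c a := ⟨a, h⟩
  rw [polarCoeff, dif_pos hex]
  exact IsLAEPolWith.unique hN hξ hex.choose_spec h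

variable [CompleteSpace K] {C : ℕ → ℝ}

theorem ClassAnalytic.isLAEReg (hξn : ‖ξ‖ = 1) {c : ℕ → K} (hc : ClassAnalytic p N α ξ C c)
    (hC : Tame p C) (hC0 : ∀ l, 0 ≤ C l) (hanti : Antitone C) : IsLAEReg p N α ξ c := by
  intro n₀
  obtain ⟨κ, -, hκ⟩ := hc.exists_isExpansionAt hξn hC hC0 hanti (n₀.appr_lt α)
    (norm_sub_appr_le α n₀)
  exact ⟨κ, hκ⟩

theorem ClassAnalytic.isLAEPolWith (hξn : ‖ξ‖ = 1) {c c' : ℕ → K} {a : Fin N → K}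
    (hc : ClassAnalytic p N α ξ C c') (hC : Tame p C) (hC0 : ∀ l, 0 ≤ C l) (hanti : Antitone C)
    (hcc : ∀ n, n ≠ 0 → c n = c' n + ∑ i : Fin N, a i * polarSeq p N α ξ i n) :
    IsLAEPolWith p N α ξ c a := by
  have hreg := hc.isLAEReg hξn hC hC0 hanti
  have hdvd : ∀ n : ℕ, ‖(n : ℤ_[p])‖ ≤ (p : ℝ) ^ (-(α : ℤ)) ↔ p ^ α ∣ n := fun n => by
    have := PadicInt.norm_int_le_pow_iff_dvd (p := p) (k := (n : ℤ)) (n := α)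
    rw [Int.cast_natCast] at this
    rw [this]
    exact_mod_cast Iff.rfl
  refine ⟨?_, fun n₀ hn₀ => ?_⟩
  · obtain ⟨κ, hκ⟩ := hreg 0
    refine ⟨κ, hκ.congr fun n hn hn0 => ?_⟩
    rw [sub_zero, hdvd] at hn0
    rw [hcc n (by omega), eq_sub_iff_add_eq]
    simp only [polarSeq, if_pos hn0, mul_assoc]
  · obtain ⟨κ, hκ⟩ := hreg n₀
    refine ⟨κ, hκ.congr fun n hn hnn => ?_⟩
    have hnd : ¬ p ^ α ∣ n := by
      rw [← hdvd]
      intro hle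
      refine absurd hn₀ (not_lt.2 ?_)
      rw [show n₀ = (n : ℤ_[p]) + -(n - n₀) by ring]
      exact (PadicInt.nonarchimedean _ _).trans (max_le hle (by rwa [norm_neg]))
    rw [hcc n (by omega)]
    simp [polarSeq, hnd]

/-- Multiplication by `p ^ α / n` followed by regularization preserves exponential-analyticity on
the classes. -/
theorem ClassAnalytic.exists_regLAE_eq (hN : p.Coprime N) (hξ : IsPrimitiveRoot ξ N)
    {B : ℕ → ℝ} {b c : ℕ → K} (hc : ClassAnalytic p N α ξ B c)
    (hb : ∀ n, n ≠ 0 → b n = (p : K) ^ α * c n / n) (hC : Tame p C) (hC0 : ∀ l, 0 ≤ C l)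
    (hanti : Antitone C) (hBC : ∀ l, B l ≤ p * C l) (hBC' : ∀ l, B (l + 1) ≤ C l)
    (hCC : ∀ l, (p : ℝ)⁻¹ * C l ≤ C (l + 1)) :
    ∃ c' : ℕ → K, ClassAnalytic p N α ξ C c' ∧ ∀ n, n ≠ 0 → regLAE p N α ξ b n = c' n := by
  have hp := (Fact.out : p.Prime)
  have hN0 := ne_zero_of_coprime p hN
  have hξn := norm_of_pow_eq_one hN0 hξ.pow_eq_one
  obtain ⟨a, c', hc', hcc⟩ := hc.exists_regularization (hξ.ne_zero hN0) hBC hBC' hCC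
    (hC.summable hp hC0).tendsto_atTop_zero
  have hbc : ∀ n, n ≠ 0 → b n = c' n + ∑ i : Fin N, a i * polarSeq p N α ξ i n :=
    fun n hn => (hb n hn).trans (hcc n hn)
  refine ⟨c', hc', fun n hn => ?_⟩
  rw [regLAE, polarCoeff_eq hN hξ (hc'.isLAEPolWith hξn hC hC0 hanti hbc), hbc n hn,
    add_sub_cancel_right]

end Regularization

/-! ### The bounds in terms of weight and depth -/

section DepthBound

/-- The bound `p ^ (-(k - 2 d - (d / log p) log max (k + 1 - d, d / log p)))`. For a word of weight
`s` and depth `d + 1`, the coefficient of index `l` in the variable `u` is bounded by its value at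
`k = l + s`: on each class the weight and the index enter through their sum only. -/
def depthBound (p d k : ℕ) : ℝ :=
  (p : ℝ) ^ (-((k : ℝ) - 2 * d -
    d / Real.log p * Real.log (max ((k : ℝ) + 1 - d) (d / Real.log p))))

variable {p : ℕ}

theorem log_prime_pos (hp : p.Prime) : 0 < Real.log p := Real.log_pos (by exact_mod_cast hp.one_lt)

theorem depthBound_pos (hp : p.Prime) (d k : ℕ) : 0 < depthBound p d k :=
  Real.rpow_pos_of_pos (by exact_mod_cast hp.pos) _

theorem depthBound_zero (hp : p.Prime) (k : ℕ) : depthBound p 0 k = (p : ℝ)⁻¹ ^ k := by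
  have hp0 : (0 : ℝ) < p := by exact_mod_cast hp.pos
  simp [depthBound, Real.rpow_neg hp0.le]

theorem inv_mul_depthBound_le (hp : p.Prime) (d k : ℕ) :
    (p : ℝ)⁻¹ * depthBound p d k ≤ depthBound p d (k + 1) := by
  have hp1 : (1 : ℝ) < p := by exact_mod_cast hp.one_lt
  have hp0 : (0 : ℝ) < p := by linarith
  have hL := log_prime_pos hp
  rw [depthBound, depthBound, ← Real.rpow_neg_one, ← Real.rpow_add hp0]
  refine Real.rpow_le_rpow_of_exponent_le hp1.le ?_
  rcases Nat.eq_zero_or_pos d with rfl | hd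
  · simp
  · have hd' : (0 : ℝ) < d := by exact_mod_cast hd
    have hc : 0 < (d : ℝ) / Real.log p := by positivity
    have h1 : Real.log (max ((k : ℝ) + 1 - d) (d / Real.log p)) ≤
        Real.log (max (((k + 1 : ℕ) : ℝ) + 1 - d) (d / Real.log p)) := by
      refine Real.log_le_log (lt_max_of_lt_right hc) (max_le_max_right _ ?_)
      push_cast; linarith
    have h2 := mul_le_mul_of_nonneg_left h1 hc.le
    push_cast at h2 ⊢
    linarith

/-- The exponent `x - c log max (x + a, c)` is nondecreasing in `x`, since the slope of `c log` is
at most `1` beyond `c`. -/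
theorem depthBound_antitone (hp : p.Prime) (d : ℕ) : Antitone (depthBound p d) := by
  refine antitone_nat_of_succ_le fun k => ?_
  have hp1 : (1 : ℝ) < p := by exact_mod_cast hp.one_lt
  have hL := log_prime_pos hp
  rw [depthBound, depthBound]
  refine Real.rpow_le_rpow_of_exponent_le hp1.le ?_
  rcases Nat.eq_zero_or_pos d with rfl | hd
  · simp
  · have hd' : (0 : ℝ) < d := by exact_mod_cast hd
    set c : ℝ := (d : ℝ) / Real.log p with hcdef
    have hc : 0 < c := by positivity
    set M : ℝ := max ((k : ℝ) + 1 - d) c with hM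
    have hcM : c ≤ M := le_max_right _ _
    have hM0 : 0 < M := hc.trans_le hcM
    have h1 : Real.log (max (((k + 1 : ℕ) : ℝ) + 1 - d) c) ≤ Real.log M + 1 / M := by
      have h2 : max (((k + 1 : ℕ) : ℝ) + 1 - d) c ≤ M * (1 + 1 / M) := by
        rw [mul_add, mul_one, mul_one_div_cancel hM0.ne']
        refine max_le ?_ (by linarith)
        have := le_max_left ((k : ℝ) + 1 - d) c
        push_cast; linarith
      refine (Real.log_le_log (lt_max_of_lt_right hc) h2).trans ?_
      rw [Real.log_mul hM0.ne' (by positivity)]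
      have := Real.log_le_sub_one_of_pos (x := 1 + 1 / M) (by positivity)
      linarith
    have h2 := mul_le_mul_of_nonneg_left h1 hc.le
    have h3 : c * (1 / M) ≤ 1 := by
      rw [mul_one_div, div_le_one hM0]; exact hcM
    push_cast at h2 ⊢
    linarith

/-- Passage from depth `d + 1` to depth `d + 2`: the summation costs `p (l + 1)`, and `l + 1` is
absorbed by the increase of the logarithmic term. -/
theorem mul_depthBound_le (hp : p.Prime) {d s : ℕ} (hs : d + 1 ≤ s) (l : ℕ) :
    p * ((l : ℝ) + 1) * depthBound p d (l + s) ≤ depthBound p (d + 1) (l + s + 1) := by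
  have hp1 : (1 : ℝ) < p := by exact_mod_cast hp.one_lt
  have hp0 : (0 : ℝ) < p := by linarith
  have hL := log_prime_pos hp
  have hs' : (d : ℝ) + 1 ≤ s := by exact_mod_cast hs
  have hl0 : (0 : ℝ) ≤ l := by positivity
  have hl : ((l : ℝ) + 1) = (p : ℝ) ^ (Real.log (l + 1) / Real.log p) := by
    rw [Real.rpow_def_of_pos hp0, mul_div_cancel₀ _ hL.ne', Real.exp_log (by positivity)]
  nth_rewrite 1 [← Real.rpow_one (p : ℝ)]
  rw [hl, depthBound, depthBound, ← Real.rpow_add hp0, ← Real.rpow_add hp0]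
  refine Real.rpow_le_rpow_of_exponent_le hp1.le ?_
  push_cast
  set A : ℝ := max ((l : ℝ) + s + 1 + 1 - (d + 1)) (((d : ℝ) + 1) / Real.log p) with hA
  have hA1 : (l : ℝ) + 1 ≤ A := le_max_of_le_left (by linarith)
  have h1 : Real.log ((l : ℝ) + 1) ≤ Real.log A := Real.log_le_log (by positivity) hA1
  have h2 : Real.log (max ((l : ℝ) + s + 1 - d) (d / Real.log p)) ≤ Real.log A := by
    refine Real.log_le_log (lt_max_of_lt_left (by linarith)) (max_le_max (by linarith) ?_)
    gcongr; linarith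
  have h3 := mul_le_mul_of_nonneg_left h2 (by positivity : 0 ≤ (d : ℝ) / Real.log p)
  have h4 : Real.log ((l : ℝ) + 1) / Real.log p ≤ Real.log A / Real.log p := by gcongr
  have h5 : ((d : ℝ) + 1) / Real.log p * Real.log A =
      d / Real.log p * Real.log A + Real.log A / Real.log p := by ring
  linarith

theorem tame_depthBound (hp : p.Prime) (d s : ℕ) : Tame p fun l => depthBound p d (l + s) := by
  have hp1 : (1 : ℝ) < p := by exact_mod_cast hp.one_lt
  have hL := log_prime_pos hp
  refine ⟨2 * d + 1, d + 1, s + 1 + d / Real.log p, by positivity, by positivity, by positivity,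
    fun l => ?_⟩
  refine Real.rpow_le_rpow_of_exponent_le hp1.le ?_
  have hc : 0 ≤ (d : ℝ) / Real.log p := by positivity
  have hl : (0 : ℝ) ≤ l := by positivity
  have hs : (0 : ℝ) ≤ s := by positivity
  have hd : (0 : ℝ) ≤ d := by positivity
  set Y : ℝ := Real.log ((l : ℝ) + (s + 1 + d / Real.log p)) with hY
  have hY0 : 0 ≤ Y := Real.log_nonneg (by linarith)
  have h1 : d / Real.log p * Real.log (max (((l + s : ℕ) : ℝ) + 1 - d) (d / Real.log p)) ≤
      d / Real.log p * Y := by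
    rcases Nat.eq_zero_or_pos d with rfl | hd'
    · simp
    · have hd'' : (0 : ℝ) < d := by exact_mod_cast hd'
      refine mul_le_mul_of_nonneg_left (Real.log_le_log
        (lt_max_of_lt_right (by positivity)) (max_le ?_ ?_)) hc
      · push_cast; linarith
      · linarith
  have h2 : ((d : ℝ) + 1) / Real.log p * Y = d / Real.log p * Y + Y / Real.log p := by ring
  have h3 : 0 ≤ Y / Real.log p := by positivity
  push_cast at h1 ⊢
  linarith

end DepthBound

/-! ### Induction on words -/

section IteratedIntegrals

variable {p : ℕ} [Fact p.Prime] {K : Type*} [NormedField K] [NormedAlgebra ℚ_[p] K]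
  {N α : ℕ} {ξ : K}

open PowerSeries in
/-- Since `z / (z - z_i) = -∑_{k ≥ 1} z_i ^ (-k) z ^ k`, the coefficients of a product with this
series are twisted partial sums. -/
theorem coeff_mul_formSeries (hξ : ξ ≠ 0) (i : Fin N) (f : K⟦X⟧) (n : ℕ) :
    coeff n (f * formSeries ξ (Letter.e i)) =
      -(ξ ^ ((i : ℕ) * n))⁻¹ * ∑ m ∈ Finset.range n, ξ ^ ((i : ℕ) * m) * coeff m f := by
  set z : K := ξ ^ (i : ℕ) with hz
  have hz0 : z ≠ 0 := pow_ne_zero _ hξ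
  have hG : f * formSeries ξ (Letter.e i) =
      PowerSeries.mk fun n => -(z ^ n)⁻¹ * ∑ m ∈ Finset.range n, z ^ m * coeff m f := by
    rw [formSeries, ← mul_assoc, eq_comm, PowerSeries.eq_mul_inv_iff_mul_eq (by
      rw [map_sub, constantCoeff_X, constantCoeff_C, zero_sub]
      exact neg_ne_zero.2 hz0)]
    ext n
    cases n with
    | zero => simp [mul_sub, coeff_zero_eq_constantCoeff]
    | succ n =>
      rw [mul_sub, map_sub, coeff_succ_mul_X, coeff_mul_C, coeff_succ_mul_X, coeff_mk, coeff_mk,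
        Finset.sum_range_succ, pow_succ]
      have := pow_ne_zero n hz0
      field_simp
      ring
  rw [hG, coeff_mk]
  simp only [hz, pow_mul]

theorem regIntegralCoeff_cons (x : Letter N) (w : Word N) {n : ℕ} (hn : n ≠ 0) :
    regIntegralCoeff p α ξ (x :: w) n = regLAE p N α ξ (fun m =>
      (p : K) ^ α * PowerSeries.coeff m (regIntegral p α ξ w * formSeries ξ x) / m) n := by
  simp [regIntegralCoeff, regIntegral, integrate, hn]

theorem coeff_zero_regIntegral_cons (x : Letter N) (w : Word N) :
    PowerSeries.coeff 0 (regIntegral p α ξ (x :: w)) = 0 := by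
  simp [regIntegral]

variable [IsUltrametricDist K] [CompleteSpace K]

/-- The values of `c_w` at `n ≠ 0` are those of a sequence that is exponential-analytic on the
classes, with the bounds `depthBound p d (l + s)`. The two differ at `n = 0`, where the coefficient
of the power series is `0` and the other sequence takes the value of the expansion at `0`. -/
theorem exists_classAnalytic_regIntegralCoeff (hN : p.Coprime N) (hξ : IsPrimitiveRoot ξ N)
    (w : Word N) (hconv : w.IsConvergent) (d : ℕ) (hdepth : w.depth = d + 1) :
    ∃ c : ℕ → K, ClassAnalytic p N α ξ (fun l => depthBound p d (l + w.weight)) c ∧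
      ∀ n, n ≠ 0 → regIntegralCoeff p α ξ w n = c n := by
  have hp := (Fact.out : p.Prime)
  have hp1 : (1 : ℝ) < p := by exact_mod_cast hp.one_lt
  have hp0 : (0 : ℝ) < p := by linarith
  have hN0 := ne_zero_of_coprime p hN
  have hξ0 := hξ.ne_zero hN0
  have hξn := norm_of_pow_eq_one hN0 hξ.pow_eq_one
  induction w generalizing d with
  | nil => simp [Word.depth] at hdepth
  | cons x w ih =>
    have hweight : Word.weight (x :: w) = Word.weight w + 1 := rfl
    have htame := tame_depthBound hp d (Word.weight (x :: w))
    have hpos : ∀ l, 0 ≤ depthBound p d (l + Word.weight (x :: w)) :=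
      fun l => (depthBound_pos hp d _).le
    have hanti : Antitone fun l => depthBound p d (l + Word.weight (x :: w)) :=
      fun a b hab => depthBound_antitone hp d (by omega)
    have hunit : ∀ l, (p : ℝ)⁻¹ * depthBound p d (l + Word.weight (x :: w)) ≤
        depthBound p d (l + 1 + Word.weight (x :: w)) := fun l => by
      rw [show l + 1 + Word.weight (x :: w) = l + Word.weight (x :: w) + 1 by ring]
      exact inv_mul_depthBound_le hp d _
    have hunit' : ∀ k, depthBound p d k ≤ p * depthBound p d (k + 1) := fun k => by
      have := inv_mul_depthBound_le hp d k
      rwa [inv_mul_le_iff₀ hp0] at this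
    -- It remains to analyse the multiplication by the series of the form attached to `x`.
    suffices hmain : ∃ (B : ℕ → ℝ) (c : ℕ → K), ClassAnalytic p N α ξ B c ∧
        (∀ n, n ≠ 0 → PowerSeries.coeff n (regIntegral p α ξ w * formSeries ξ x) = c n) ∧
        (∀ l, B l ≤ p * depthBound p d (l + Word.weight (x :: w))) ∧
        (∀ l, B (l + 1) ≤ depthBound p d (l + Word.weight (x :: w))) by
      obtain ⟨B, c, hc, hcoeff, hB, hB'⟩ := hmain
      obtain ⟨c', hc', hreg⟩ := hc.exists_regLAE_eq hN hξ
        (b := fun m => (p : K) ^ α * PowerSeries.coeff m (regIntegral p α ξ w * formSeries ξ x) / m)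
        (fun n hn => by rw [hcoeff n hn]) htame hpos hanti hB hB' hunit
      exact ⟨c', hc', fun n hn => (regIntegralCoeff_cons x w hn).trans (hreg n hn)⟩
    cases w with
    | nil =>
      cases x with
      | e0 => simp [Word.IsConvergent] at hconv
      | e i =>
        have hd : d = 0 := by
          simp [Word.depth, Letter.isSingular] at hdepth
          omega
        subst hd
        have hB0 : ∀ l : ℕ, (0 : ℝ) ≤ if l = 0 then 1 else 0 := fun l => by positivity
        -- The series `z / (z - z_i)` itself has coefficients `-ξ ^ (-i n)`, for `n ≥ 1`.
        refine ⟨fun l => if l = 0 then 1 else 0, fun n => -(ξ ^ ((i : ℕ) * n))⁻¹, fun r hr => ?_,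
          fun n hn => ?_, fun l => ?_, fun l => ?_⟩
        · have h1 := (ExpAnalytic.const (η := (ξ ^ p ^ α)⁻¹) hN0 hB0
            (a := -(ξ ^ ((i : ℕ) * r))⁻¹) (by simp [hξn])).char_mul hN0
            (isPrimitiveRoot_inv_pow hN hξ).pow_eq_one i
          convert h1 using 2 with u
          rw [inv_pow, ← pow_mul, mul_neg, ← mul_inv, ← pow_add]
          ring_nf
        · obtain ⟨n, rfl⟩ := Nat.exists_eq_succ_of_ne_zero hn
          rw [coeff_mul_formSeries hξ0]
          simp only [regIntegral]
          rw [Finset.sum_range_succ', Finset.sum_eq_zero (fun m _ => by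
            rw [PowerSeries.coeff_one, if_neg (Nat.succ_ne_zero m), mul_zero])]
          simp
        · rw [depthBound_zero hp]
          rcases Nat.eq_zero_or_pos l with rfl | hl
          · simp [Word.weight, hp0.ne']
          · simp only [hl.ne', if_false]; positivity
        · simp only [Nat.succ_ne_zero, if_false]
          exact hpos l
    | cons y w =>
      have hconv' : Word.IsConvergent (y :: w) := by
        simpa [Word.IsConvergent] using hconv
      cases x with
      | e0 =>
        obtain ⟨c, hc, hcoeff⟩ := ih hconv' d
          (by simpa [Word.depth, Letter.isSingular] using hdepth)
        refine ⟨_, c, hc, fun n hn => ?_, fun l => hunit' _, fun l => le_of_eq ?_⟩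
        · rw [formSeries, mul_one]
          exact hcoeff n hn
        -- the shift of the index on the class of `0` is the increase of the weight
        · rw [hweight]
          congr 1
          ring
      | e i =>
        have hdy : Word.depth (y :: w) = d := by
          have h := List.countP_cons_of_pos (p := Letter.isSingular) (a := Letter.e i)
            (l := y :: w) rfl
          exact Nat.succ_injective (h.symm.trans hdepth)
        -- A nonempty convergent word ends with a letter other than `e_0`, so its depth is not `0`.
        have hne : d ≠ 0 := by
          rintro rfl
          refine hconv' ?_
          have hall : ∀ a ∈ y :: w, a = Letter.e0 := fun a ha => by
            have := List.countP_eq_zero.1 hdy a ha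
            cases a with
            | e0 => rfl
            | e j => simp [Letter.isSingular] at this
          rw [List.getLast?_eq_some_getLast (List.cons_ne_nil y w)]
          exact congrArg some (hall _ (List.getLast_mem _))
        obtain ⟨e, rfl⟩ := Nat.exists_eq_succ_of_ne_zero hne
        obtain ⟨c, hc, hcoeff⟩ := ih hconv' e hdy
        have hle : e + 1 ≤ Word.weight (y :: w) := hdy.symm.le.trans List.countP_le_length
        set s := Word.weight (y :: w) with hs
        have hpos' : ∀ l, 0 ≤ depthBound p e (l + s) := fun l => (depthBound_pos hp e _).le
        have hanti' : Antitone fun l => depthBound p e (l + s) :=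
          fun a b hab => depthBound_antitone hp e (by omega)
        have hstep : ∀ l, sumBound p (fun l => depthBound p e (l + s)) (l + 1) ≤
            depthBound p (e + 1) (l + s + 1) := fun l => mul_depthBound_le hp hle l
        refine ⟨_, _, hc.twistedPartialSum hN hξ.pow_eq_one hpos' hanti'
          ((tame_depthBound hp e s).tendsto_succ_mul hp hpos') i, fun n hn => ?_, fun l => ?_,
          fun l => hstep l⟩
        · obtain ⟨n, rfl⟩ := Nat.exists_eq_succ_of_ne_zero hn
          rw [coeff_mul_formSeries hξ0, Finset.sum_range_succ', Finset.sum_range_succ',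
            coeff_zero_regIntegral_cons]
          -- The term `m = 0` vanishes on the left, and cancels against `c 0` on the right.
          simp only [mul_zero, pow_zero, one_mul, add_zero, add_sub_cancel_right]
          congr 1
          exact Finset.sum_congr rfl fun m _ => by
            rw [← hcoeff (m + 1) (Nat.succ_ne_zero m), regIntegralCoeff]
        · cases l with
          | zero =>
            have h1 := mul_depthBound_le hp hle 0
            have h2 := hpos' 0
            simp only [Nat.cast_zero, zero_add, mul_one] at h1 h2
            simp only [sumBound, zero_add, hweight]
            have h3 := depthBound_pos hp (e + 1) (s + 1)
            nlinarith
          | succ l =>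
            refine (hstep l).trans ((hunit' _).trans (le_of_eq ?_))
            rw [hweight]
            congr 2
            ring

end IteratedIntegrals

/-! ### The continuous extension -/

section Extension

variable {p : ℕ} [Fact p.Prime] {K : Type*} [NormedField K]

theorem le_vp_of_norm_le {x : K} {t : ℝ} (h : ‖x‖ ≤ (p : ℝ) ^ (-t)) : (t : EReal) ≤ vp p x := by
  have hp0 : (0 : ℝ) < p := by exact_mod_cast (Fact.out : p.Prime).pos
  have hL := log_prime_pos (Fact.out : p.Prime)
  rw [vp]
  split_ifs with hx
  · exact le_top
  · have h1 := Real.log_le_log (norm_pos_iff.2 hx) h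
    rw [Real.log_rpow hp0] at h1
    rw [EReal.coe_le_coe_iff, le_neg, div_le_iff₀ hL]
    exact h1

theorem appr_eq_of_norm_sub_le {α r : ℕ} (hr : r < p ^ α) {x : ℤ_[p]}
    (h : ‖x - r‖ ≤ (p : ℝ) ^ (-(α : ℤ))) : x.appr α = r := by
  have h1 : ‖((x.appr α : ℕ) : ℤ_[p]) - r‖ ≤ (p : ℝ) ^ (-(α : ℤ)) := by
    rw [show ((x.appr α : ℕ) : ℤ_[p]) - r = -(x - x.appr α) + (x - r) by ring]
    refine (PadicInt.nonarchimedean _ _).trans (max_le ?_ h)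
    rw [norm_neg]
    exact norm_sub_appr_le α x
  obtain ⟨u, hu⟩ := exists_eq_mul_add_of_norm_sub_le hr h1
  have h2 := x.appr_lt α
  rcases Nat.eq_zero_or_pos u with rfl | hu0
  · simpa using hu
  · have := Nat.le_mul_of_pos_right (p ^ α) hu0
    omega

variable [NormedAlgebra ℚ_[p] K] [IsUltrametricDist K] {N α : ℕ} {ξ : K}
  {C : ℕ → ℝ}

/-- The function on `ℤ_p^{(N)}` whose restriction to the class `r + p ^ α ℤ_p` is given by the
expansion with coefficients `κ r`. -/
def extension (α : ℕ) (ξ : K) (κ : ℕ → ℕ → Fin N → K) (x : ZpN p N) : K :=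
  ∑' l : ℕ, ∑ i : Fin N, κ (x.2.appr α) l i * (ξ ^ ((i : ℕ) * x.1.val))⁻¹ *
    (algebraMap ℚ_[p] K ((x.2 - (x.2.appr α : ℤ_[p]) : ℤ_[p]) : ℚ_[p])) ^ l

theorem norm_expansion_term_le (hξn : ‖ξ‖ = 1) {κ : Fin N → K} {l : ℕ} (hC0 : 0 ≤ C l)
    (hκ : ∀ i, ‖κ i‖ ≤ C l * (p : ℝ) ^ (α * l)) (a : ℕ) {y : ℤ_[p]}
    (hy : ‖y‖ ≤ (p : ℝ) ^ (-(α : ℤ))) :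
    ‖∑ i : Fin N, κ i * (ξ ^ ((i : ℕ) * a))⁻¹ * (algebraMap ℚ_[p] K (y : ℚ_[p])) ^ l‖ ≤ C l := by
  have hp0 : (0 : ℝ) < p := by exact_mod_cast (Fact.out : p.Prime).pos
  refine IsUltrametricDist.norm_sum_le_of_forall_le_of_nonneg hC0 fun i _ => ?_
  rw [norm_mul, norm_mul, norm_inv, norm_pow ξ, hξn, one_pow, inv_one, mul_one, norm_pow,
    norm_algebraMap']
  calc ‖κ i‖ * ‖(y : ℚ_[p])‖ ^ l
      ≤ C l * (p : ℝ) ^ (α * l) * ((p : ℝ) ^ (-(α : ℤ))) ^ l := by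
        gcongr
        · exact hκ i
        · exact hy
    _ = C l := by
        rw [zpow_neg, zpow_natCast, inv_pow, ← pow_mul, mul_assoc,
          mul_inv_cancel₀ (pow_ne_zero _ hp0.ne'), mul_one]

theorem continuous_extension [CompleteSpace K] (hξn : ‖ξ‖ = 1) (hC : Summable C)
    (hC0 : ∀ l, 0 ≤ C l) {κ : ℕ → ℕ → Fin N → K}
    (hκ : ∀ r < p ^ α, ∀ l i, ‖κ r l i‖ ≤ C l * (p : ℝ) ^ (α * l)) :
    Continuous (extension (p := p) α ξ κ) := by
  have hp0 : (0 : ℝ) < p := by exact_mod_cast (Fact.out : p.Prime).pos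
  rw [continuous_prod_of_discrete_left]
  intro a
  rw [continuous_iff_continuousAt]
  intro x₀
  set r := x₀.appr α with hr
  have hrlt : r < p ^ α := x₀.appr_lt α
  set U : Set ℤ_[p] := {x | ‖x - r‖ ≤ (p : ℝ) ^ (-(α : ℤ))} with hU
  have hUnhds : U ∈ 𝓝 x₀ := by
    refine mem_of_superset (Metric.closedBall_mem_nhds x₀
      (by positivity : 0 < (p : ℝ) ^ (-(α : ℤ)))) fun x hx => ?_
    rw [Metric.mem_closedBall, dist_eq_norm] at hx
    rw [hU, Set.mem_ofPred_eq, show x - (r : ℤ_[p]) = (x - x₀) + (x₀ - r) by ring]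
    exact (PadicInt.nonarchimedean _ _).trans (max_le hx (norm_sub_appr_le α x₀))
  have hcont : ContinuousOn (fun x : ℤ_[p] => ∑' l : ℕ, ∑ i : Fin N, κ r l i *
      (ξ ^ ((i : ℕ) * a.val))⁻¹ *
      (algebraMap ℚ_[p] K ((x - (r : ℤ_[p]) : ℤ_[p]) : ℚ_[p])) ^ l) U := by
    refine continuousOn_tsum (fun l => ?_) hC fun l x hx =>
      norm_expansion_term_le hξn (hC0 l) (hκ r hrlt l) _ hx
    have h1 : Continuous fun x : ℤ_[p] =>
        algebraMap ℚ_[p] K ((x - (r : ℤ_[p]) : ℤ_[p]) : ℚ_[p]) :=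
      (continuous_algebraMap ℚ_[p] K).comp (continuous_subtype_val.comp
        (continuous_id.sub continuous_const))
    exact (by fun_prop : Continuous _).continuousOn
  refine (hcont.continuousAt hUnhds).congr ?_
  filter_upwards [hUnhds] with x hx
  simp only [extension, appr_eq_of_norm_sub_le hrlt hx]

theorem extension_ofNat (hξ : ξ ^ N = 1) {c : ℕ → K} {κ : ℕ → ℕ → Fin N → K}
    (hκ : ∀ r < p ^ α, IsExpansionAt p N α ξ c (r : ℤ_[p]) (κ r)) {n : ℕ} (hn : 1 ≤ n) :
    extension α ξ κ (ZpN.ofNat p N n) = c n := by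
  have h := ((hκ _ ((n : ℤ_[p]).appr_lt α)).2 n hn (norm_sub_appr_le α _)).tsum_eq
  rw [← h, extension]
  refine tsum_congr fun l => Finset.sum_congr rfl fun i _ => ?_
  simp only [ZpN.ofNat]
  congr 3
  rw [ZMod.val_natCast, mul_comm, mul_comm (i : ℕ), pow_mul, pow_mul, ← pow_mod_orderOf ξ n,
    ← pow_mod_orderOf ξ (n % N), Nat.mod_mod_of_dvd n (orderOf_dvd_of_pow_eq_one hξ)]

theorem norm_extension_le (hξn : ‖ξ‖ = 1) (hC0 : ∀ l, 0 ≤ C l) (hanti : Antitone C)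
    {κ : ℕ → ℕ → Fin N → K} (hκ : ∀ r < p ^ α, ∀ l i, ‖κ r l i‖ ≤ C l * (p : ℝ) ^ (α * l))
    (x : ZpN p N) : ‖extension α ξ κ x‖ ≤ C 0 :=
  IsUltrametricDist.norm_tsum_le_of_forall_le_of_nonneg (hC0 0) fun l =>
    (norm_expansion_term_le hξn (hC0 l) (hκ _ (x.2.appr_lt α) l) _
      (norm_sub_appr_le α x.2)).trans (hanti (Nat.zero_le l))

/-- The comparison `d / log p ≤ s + 1 + d` rests on `1 / log 2 < 2`. -/
theorem max_le_add_of_lt {d s : ℕ} (hs : d + 1 ≤ s) :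
    max ((s : ℝ) + 1 - d) (d / Real.log p) ≤ s + 1 + d := by
  have hL := log_prime_pos (Fact.out : p.Prime)
  have hs' : (d : ℝ) + 1 ≤ s := by exact_mod_cast hs
  have hd : (0 : ℝ) ≤ d := by positivity
  refine max_le (by linarith) ?_
  have h2 : Real.log 2 ≤ Real.log p :=
    Real.log_le_log two_pos (by exact_mod_cast (Fact.out : p.Prime).two_le)
  have h3 := Real.log_two_gt_d9
  rw [div_le_iff₀ hL]
  nlinarith

end Extension

end PAdicHyperlog

end

theorem proposition4p5
    (p : ℕ) [Fact p.Prime]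
    (K : Type*) [NormedField K] [NormedAlgebra ℚ_[p] K] [IsUltrametricDist K] [CompleteSpace K]
    (N : ℕ) (hN : p.Coprime N) (ξ : K) (hξ : IsPrimitiveRoot ξ N)
    (α : ℕ) (hα : 1 ≤ α) (d s : ℕ)
    (w : PAdicHyperlog.Word N) (hconv : w.IsConvergent)
    (hdepth : w.depth = d + 1) (hweight : w.weight = s) :
    -- the sequence of coefficients has analytic-exponential expansions
    PAdicHyperlog.IsLAEReg p N α ξ (PAdicHyperlog.regIntegralCoeff p α ξ w) ∧
    -- bound for the coefficients of the expansions
    (∀ r : ℕ, r < p ^ α → ∀ κ : ℕ → Fin N → K,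
      PAdicHyperlog.IsExpansionAt p N α ξ (PAdicHyperlog.regIntegralCoeff p α ξ w)
        (r : ℤ_[p]) κ →
      ∀ (l : ℕ) (i : Fin N),
        (((s : ℝ) - 2 * d
          - (d : ℝ) / Real.log p *
              Real.log (max ((l : ℝ) + s + 1 - d) ((d : ℝ) / Real.log p))
          - ((α : ℝ) - 1) * l : ℝ) : EReal) ≤ PAdicHyperlog.vp p (κ l i)) ∧
    -- bound for the values of the continuous extension
    (∃ F : PAdicHyperlog.ZpN p N → K, Continuous F ∧
      (∀ n : ℕ, 1 ≤ n →
        F (PAdicHyperlog.ZpN.ofNat p N n) = PAdicHyperlog.regIntegralCoeff p α ξ w n) ∧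
      ∀ x : PAdicHyperlog.ZpN p N,
        (((s : ℝ) - 2 * d - (d : ℝ) / Real.log p * Real.log ((s : ℝ) + 1 + d) : ℝ) : EReal)
          ≤ PAdicHyperlog.vp p (F x)) := by
  open PAdicHyperlog in
  have hp := (Fact.out : p.Prime)
  have hp1 : (1 : ℝ) < p := by exact_mod_cast hp.one_lt
  have hp0 : (0 : ℝ) < p := by linarith
  have hL := log_prime_pos hp
  have hN0 := ne_zero_of_coprime p hN
  have hξn := norm_of_pow_eq_one hN0 hξ.pow_eq_one
  have hds : d + 1 ≤ s := by
    rw [← hdepth, ← hweight]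
    exact List.countP_le_length
  obtain ⟨c, hc, hwc⟩ := exists_classAnalytic_regIntegralCoeff (α := α) hN hξ w hconv d hdepth
  rw [hweight] at hc
  have htame := tame_depthBound hp d s
  have hpos : ∀ l, 0 ≤ depthBound p d (l + s) := fun l => (depthBound_pos hp d _).le
  have hanti : Antitone fun l => depthBound p d (l + s) :=
    fun a b hab => depthBound_antitone hp d (by omega)
  choose! κ₀ hκ₀ hexp' using fun r (hr : r < p ^ α) => hc.exists_isExpansionAt hξn htame hpos hanti
    hr (n₀ := (r : ℤ_[p])) (by rw [sub_self, norm_zero]; positivity)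
  have hexp : ∀ r < p ^ α, IsExpansionAt p N α ξ (regIntegralCoeff p α ξ w) (r : ℤ_[p]) (κ₀ r) :=
    fun r hr => (hexp' r hr).congr fun n hn _ => (hwc n (by omega)).symm
  refine ⟨fun n₀ => ?_, fun r hr κ hκ l i => ?_, extension α ξ κ₀,
    continuous_extension hξn (htame.summable hp hpos) hpos hκ₀,
    fun n hn => extension_ofNat hξ.pow_eq_one hexp hn, fun x => ?_⟩
  · obtain ⟨κ, hκ⟩ := hc.isLAEReg hξn htame hpos hanti n₀
    exact ⟨κ, hκ.congr fun n hn _ => (hwc n (by omega)).symm⟩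
  · rw [hκ.unique hN hξ (hexp r hr) l i]
    refine le_vp_of_norm_le ((hκ₀ r hr l i).trans (le_of_eq ?_))
    rw [depthBound, ← Real.rpow_natCast, ← Real.rpow_add hp0]
    congr 1
    push_cast
    ring
  · refine le_vp_of_norm_le ((norm_extension_le hξn hpos hanti hκ₀ x).trans ?_)
    rw [depthBound]
    refine Real.rpow_le_rpow_of_exponent_le hp1.le ?_
    have hs : (d : ℝ) + 1 ≤ s := by exact_mod_cast hds
    have h1 := mul_le_mul_of_nonneg_left (Real.log_le_log (lt_max_of_lt_left (by linarith))
      (max_le_add_of_lt (p := p) hds)) (by positivity : 0 ≤ (d : ℝ) / Real.log p)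
    rw [zero_add]
    linarith
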